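/- **Setting.** Let $\gamma>0$, $0<m<1$, $f(u)=|u|^{2m}u$ (that is, "$u^{2m+1}$"), $A=-\partial_{xx}+1$, $H=L^2(\mathbb R)$ (real valued, norm $\|\cdot\|$), $\mathcal H=H^1(\mathbb R)\times L^2(\mathbb R)$, $\|u\|_1^2=\|u\|^2+\|u_x\|^2$, and for $\alpha>0$ $$|y|_{\mathcal H}^2=\|y_1\|_1^2+\|y_2+\alpha y_1\|^2,\qquad y=(y_1,y_2)\in\mathcal H.$$ Let $(e_i)_{i\ge1}$ be an orthonormal basis of $H$ and $P_N$ the orthogonal projection of $H$ onto $\mathrm{span}\{e_1,\dots,e_N\}$. Let $h\in H$ and $W(t)=\sum_i b_i\beta_i(t)e_i$ with $\sum_i b_i^2<\infty$ and independent standard Brownian motions $\beta_i$ on a filtered probability space satisfying the usual conditions, and let $\eta=\partial_tW$. Let $\xi_u=(u,\dot u)$ and $\xi_v=(v,\dot v)$ be mild solutions on $[0,\infty)$, with continuous paths in $\mathcal H$ and $\mathcal F_0$-measurable initial values, of $$\ddot u+Au+\gamma\dot u+f(u)=h+\eta,\qquad \ddot v+Av+\gamma\dot v+f(v)+P_N(f(u)-f(v))=h+\eta\qquad\text{on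 }\mathbb R .$$ Here a mild solution of $\ddot y_1+Ay_1+\gamma\dot y_1=g+\eta$ is a process $y=(y_1,y_2)$ with, almost surely for all $t\ge0$, $y(t)=U(t)y(0)+\int_0^tU(t-s)(0,g(s))\,ds+\int_0^tU(t-s)(0,dW(s))$, where $U$ is the strongly continuous group on $\mathcal H$ generated by $(y_1,y_2)\mapsto(y_2,-Ay_1-\gamma y_2)$ with domain $H^2(\mathbb R)\times H^1(\mathbb R)$. Finally, let $$\psi(t,x)=\varphi(x)\bigl(1-e^{-t/\varphi(x)}\bigr),\qquad \varphi(x)=\ln(x^2+2).$$ **Theorem.** There exists $\alpha>0$, depending only on $\gamma$ and $m$, such that, with the norm $|\cdot|_{\mathcal H}$ formed with this $\alpha$, the following hold. (1) There is a constant $C>0$, depending only on $\gamma,m,\alpha$, such that for all data as above and every $N\ge1$, almost surely, for all $t\ge s\ge0$, $$|\xi_u(t)-\xi_v(t)|_{\mathcal H}^2\le|\xi_u(s)-\xi_v(s)|_{\mathcal H}^2\exp\Bigl(-\alpha(t-s)+C\int_s^t(\|u\|_1^2+\|v\|_1^2)\,dr\Bigr).$$ (2) There is a constant $C_*>0$,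 depending only on $\gamma,m,\alpha$, such that for every orthonormal basis $(e_i)$ of $H$ and every $\varepsilon>0$ there are a time $T_0>0$ and an integer $N\ge1$ such that for all remaining data as above with this basis and this $N$, almost surely, for all $t\ge s\ge0$, $$|\xi_u(t+T_0)-\xi_v(t+T_0)|_{\mathcal H}^2\le|\xi_u(s+T_0)-\xi_v(s+T_0)|_{\mathcal H}^2\exp\Bigl(-\alpha(t-s)+C_*\varepsilon\int_{s+T_0}^{t+T_0}(\|u\|_1^2+\|v\|_1^2+\|\psi u\|_1^2+\|\psi v\|_1^2)\,dr\Bigr).$$ Here $\|\psi u\|_1=\|\psi(r,\cdot)u(r)\|_1$ is $+\infty$ if $\psi(r,\cdot)u(r)\notin H^1(\mathbb R)$, the integral may be $+\infty$, $e^{+\infty}=+\infty$ and $0\cdot(+\infty)=0$. -/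

import Mathlib

open MeasureTheory ProbabilityTheory Filter Topology Set
open scoped NNReal ENNReal InnerProductSpace

universe u

noncomputable section

namespace WaveLine

/-- `H = L²(ℝ)`, real valued. -/
abbrev H : Type := Lp ℝ 2 (volume : Measure ℝ)

/-- `g` is the weak derivative of `u` on the line. -/
def IsWeakDeriv (u g : H) : Prop :=
  ∀ φ : ℝ → ℝ, ContDiff ℝ (⊤ : ℕ∞) φ → HasCompactSupport φ →
    ∫ x, u x * deriv φ x = -∫ x, g x * φ x

lemma integrable_mul_test (u : H) {φ : ℝ → ℝ} (hφ : Continuous φ) (hc : HasCompactSupport φ) :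
    Integrable (fun x => u x * φ x) :=
  (Lp.memLp u).integrable_mul (hφ.memLp_of_hasCompactSupport (p := 2) hc)

lemma integral_mul_test_eq (u : H) {φ : ℝ → ℝ} (hφ : Continuous φ) (hc : HasCompactSupport φ) :
    ∫ x, u x * φ x = ⟪(hφ.memLp_of_hasCompactSupport (p := 2) (μ := volume) hc).toLp φ, u⟫_ℝ := by
  rw [L2.inner_def]
  refine integral_congr_ae ?_
  filter_upwards [(hφ.memLp_of_hasCompactSupport (p := 2) (μ := volume) hc).coeFn_toLp] with x hx
  rw [hx]
  simp

lemma continuous_deriv_test {φ : ℝ → ℝ} (hφ : ContDiff ℝ (⊤ : ℕ∞) φ) : Continuous (deriv φ) :=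
  hφ.continuous_deriv (by simp)

/-- The Sobolev space `H¹(ℝ)`: an element is a function of `L²` together with its (unique) weak
derivative in `L²`.  The norm is `‖u‖₁² = ‖u‖² + ‖uₓ‖²`. -/
def h1Submodule : Submodule ℝ (WithLp 2 (H × H)) where
  carrier := {p | IsWeakDeriv p.fst p.snd}
  zero_mem' := by
    intro φ hφ hc
    have e1 := integral_mul_test_eq 0 (continuous_deriv_test hφ) hc.deriv
    have e2 := integral_mul_test_eq 0 hφ.continuous hc
    simp only [inner_zero_right] at e1 e2
    change ∫ x, (0 : H) x * deriv φ x = -∫ x, (0 : H) x * φ x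
    rw [e1, e2, neg_zero]
  add_mem' := by
    intro p q hp hq φ hφ hc
    have hp' := hp φ hφ hc
    have hq' := hq φ hφ hc
    rw [integral_mul_test_eq _ (continuous_deriv_test hφ) hc.deriv,
      integral_mul_test_eq _ hφ.continuous hc] at *
    simp only [WithLp.add_fst, WithLp.add_snd, inner_add_right]
    rw [hp', hq']
    ring
  smul_mem' := by
    intro c p hp φ hφ hc
    have hp' := hp φ hφ hc
    rw [integral_mul_test_eq _ (continuous_deriv_test hφ) hc.deriv,
      integral_mul_test_eq _ hφ.continuous hc] at *
    simp only [WithLp.smul_fst, WithLp.smul_snd, inner_smul_right]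
    rw [hp']
    ring

/-- The Sobolev space `H¹(ℝ)` as a (Hilbert) space. -/
abbrev H1 : Type := h1Submodule

/-- The embedding `H¹ ⊂ L²`. -/
def H1.toL2 (u : H1) : H := (u : WithLp 2 (H × H)).fst

/-- The derivative `u ↦ uₓ` from `H¹` to `L²`. -/
def H1.dx (u : H1) : H := (u : WithLp 2 (H × H)).snd

lemma isClosed_h1Submodule : IsClosed (h1Submodule : Set (WithLp 2 (H × H))) := by
  have : (h1Submodule : Set (WithLp 2 (H × H))) =
      ⋂ (φ : ℝ → ℝ) (hφ : ContDiff ℝ (⊤ : ℕ∞) φ) (hc : HasCompactSupport φ),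
        {p | ⟪((continuous_deriv_test hφ).memLp_of_hasCompactSupport (p := 2) (μ := volume)
              hc.deriv).toLp _, p.fst⟫_ℝ =
            -⟪(hφ.continuous.memLp_of_hasCompactSupport (p := 2) (μ := volume) hc).toLp φ,
              p.snd⟫_ℝ} := by
    ext p
    simp only [mem_iInter, mem_ofPred_eq]
    refine forall_congr' fun φ => forall_congr' fun hφ => forall_congr' fun hc => ?_
    rw [integral_mul_test_eq _ (continuous_deriv_test hφ) hc.deriv,
      integral_mul_test_eq _ hφ.continuous hc]
  rw [this]
  refine isClosed_iInter fun φ => isClosed_iInter fun hφ => isClosed_iInter fun hc => ?_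
  exact isClosed_eq
    (continuous_const.inner (WithLp.prod_continuous_ofLp 2 H H).fst)
    (continuous_const.inner (WithLp.prod_continuous_ofLp 2 H H).snd).neg

instance : CompleteSpace H1 := isClosed_h1Submodule.completeSpace_coe

/-- The phase space `𝓗 = H¹(ℝ) × L²(ℝ)` of pairs `(u, u̇)`. -/
abbrev Phase : Type := H1 × H

/-- `|y|²_𝓗 = ‖y₁‖₁² + ‖y₂ + α y₁‖²`. -/
def phaseNormSq (α : ℝ) (y : Phase) : ℝ := ‖y.1‖ ^ 2 + ‖y.2 + α • y.1.toL2‖ ^ 2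

/-- The graph of `𝔸 (u, v) = (v, -A u - γ v)`, `A = -∂ₓₓ + 1`, on its domain `H² × H¹`:
here `d = uₓ` as an element of `H¹`, so that `d.dx = uₓₓ`. -/
def WaveOp (γ : ℝ) (y z : Phase) : Prop :=
  z.1.toL2 = y.2 ∧ ∃ d : H1, d.toL2 = y.1.dx ∧ z.2 = d.dx - y.1.toL2 - γ • y.2

/-- `U` is a strongly continuous group on the phase space, with infinitesimal generator `𝔸`. -/
structure IsWaveGroup (γ : ℝ) (U : ℝ → Phase →L[ℝ] Phase) : Prop where
  zero : U 0 = ContinuousLinearMap.id ℝ Phase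
  add : ∀ s t, U (s + t) = (U s).comp (U t)
  cont : ∀ y, Continuous fun t => U t y
  generator : ∀ y z, HasDerivAt (fun t => U t y) z 0 ↔ WaveOp γ y z

open Classical in
/-- The strongly continuous group `U(t)` generated by `𝔸` on the phase space.  Such a group exists
and is unique (the value `0` in the definition below is never taken). -/
def waveGroup (γ : ℝ) : ℝ → Phase →L[ℝ] Phase :=
  if h : ∃ U, IsWaveGroup γ U then h.choose else 0

open Classical in
/-- The nonlinearity `f(u) = u^{2m+1}`, i.e. `|u|^{2m} u`, as a map `H¹ → L²` (for `m ≥ 0` the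
function `|u|^{2m} u` lies in `L²` for each `u ∈ H¹`). -/
def nonlin (m : ℝ) (u : H1) : H :=
  if h : MemLp (fun x => |u.toL2 x| ^ (2 * m) * u.toL2 x) 2 volume then h.toLp _ else 0

/-- `P_N`: the orthogonal projection of `L²` onto the span of the first `N` basis vectors. -/
def proj (e : HilbertBasis ℕ ℝ H) (N : ℕ) (x : H) : H :=
  ∑ i ∈ Finset.range N, ⟪e i, x⟫_ℝ • e i

/-- `φ(x) = ln (x² + 2)`. -/
def logWeight (x : ℝ) : ℝ := Real.log (x ^ 2 + 2)

/-- `ψ(t, x) = φ(x) (1 - exp (-t / φ(x)))`. -/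
def psi (t x : ℝ) : ℝ := logWeight x * (1 - Real.exp (-t / logWeight x))

/-- `‖g‖₁²` for a function `g` on the line, with value `∞` if `g` is not in `H¹`. -/
def eNormSqH1 (g : ℝ → ℝ) : ℝ≥0∞ :=
  ⨅ (p : H1) (_ : p.toL2 =ᵐ[volume] g), ‖p‖ₑ ^ 2

/-- `‖ψ(t, ·) u‖₁²`, with value `∞` if `ψ(t, ·) u` is not in `H¹`. -/
def weightedNormSq (t : ℝ) (u : H1) : ℝ≥0∞ :=
  eNormSqH1 fun x => psi t x * u.toL2 x

section Stochastic

variable {Ω : Type u} {mΩ : MeasurableSpace Ω}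

/-- The usual conditions: right-continuity, and `ℱ₀` contains all null sets. -/
structure UsualConditions (P : Measure Ω) (ℱ : Filtration ℝ≥0 mΩ) : Prop where
  rightCont : ∀ t, ⨅ s > t, ℱ s ≤ ℱ t
  complete : ∀ A : Set Ω, P A = 0 → MeasurableSet[ℱ 0] A

/-- `(β i)` is a sequence of independent standard real Brownian motions with respect to `ℱ`. -/
structure IsBrownianSequence (P : Measure Ω) (ℱ : Filtration ℝ≥0 mΩ)
    (β : ℕ → ℝ≥0 → Ω → ℝ) : Prop where
  brownian : ∀ i, IsBrownianReal (β i) P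
  indep : iIndepFun (fun i ω t => β i t ω) P
  adapted : ∀ i t, Measurable[ℱ t] (β i t)
  increments : ∀ s t, s ≤ t →
    Indep (MeasurableSpace.comap (fun ω i => β i t ω - β i s ω) inferInstance) (ℱ s) P

/-- `W(t) = ∑ b_i β_i(t) e_i`, the sum being taken in `L²(ℝ)`. -/
def wiener (e : HilbertBasis ℕ ℝ H) (b : ℕ → ℝ) (β : ℕ → ℝ≥0 → Ω → ℝ) (t : ℝ≥0) (ω : Ω) : H :=
  ∑' i, (b i * β i t ω) • e i

/-- The Itô sums `∑_{k<n} U(t - t_k) (0, W(t_{k+1}) - W(t_k))` with `t_k = k t / n`. -/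
def itoSum (γ : ℝ) (W : ℝ≥0 → Ω → H) (t : ℝ≥0) (n : ℕ) (ω : Ω) : Phase :=
  ∑ k ∈ Finset.range n,
    waveGroup γ ((t : ℝ) - ((k * t / n : ℝ≥0) : ℝ))
      (0, W ((k + 1) * t / n) ω - W (k * t / n) ω)

/-- `Z(t) = ∫₀ᵗ U(t - s) 𝔾 dW(s)`, `𝔾 = (0, 1)`.  The integrand is deterministic and strongly
continuous, so that the Itô integral is the limit of the Itô sums in `L²(Ω; 𝓗)`. -/
def IsStochasticConvolution (γ : ℝ) (P : Measure Ω) (W : ℝ≥0 → Ω → H)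
    (Z : ℝ≥0 → Ω → Phase) : Prop :=
  ∀ t, AEStronglyMeasurable (Z t) P ∧
    Tendsto (fun n => eLpNorm (fun ω => itoSum γ W t n ω - Z t ω) 2 P) atTop (𝓝 0)

/-- `y = (u, u̇)` is a mild solution on `[0, ∞)` of `ü + A u + γ u̇ = g + ∂W/∂t`, with continuous
paths in the phase space and an `ℱ₀`-measurable initial value:
`y(t) = U(t) y(0) + ∫₀ᵗ U(t - s) (0, g(s)) ds + ∫₀ᵗ U(t - s) 𝔾 dW(s)`.
Only the values of `y` and `g` at times `≥ 0` matter. -/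
structure IsMildSolution (γ : ℝ) (P : Measure Ω) (ℱ : Filtration ℝ≥0 mΩ) (W : ℝ≥0 → Ω → H)
    (g : ℝ → Ω → H) (y : ℝ → Ω → Phase) : Prop where
  initial : StronglyMeasurable[ℱ 0] (y 0)
  cont : ∀ᵐ ω ∂P, ContinuousOn (fun t => y t ω) (Ici 0)
  mild : ∃ Z : ℝ≥0 → Ω → Phase, IsStochasticConvolution γ P W Z ∧
    ∀ᵐ ω ∂P, ∀ t : ℝ≥0,
      y t ω = waveGroup γ t (y 0 ω)
        + (∫ s in (0 : ℝ)..t, waveGroup γ (t - s) ((0 : H1), g s ω)) + Z t ω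

/-- On a filtered probability space satisfying the usual conditions, with
`W = ∑ b_i β_i e_i`, `∑ b_i² < ∞`, `h ∈ L²(ℝ)`:
`ξ_u = (u, u̇)` solves `ü + A u + γ u̇ + f(u) = h + ∂W/∂t` and
`ξ_v = (v, v̇)` solves `v̈ + A v + γ v̇ + f(v) + P_N (f(u) - f(v)) = h + ∂W/∂t`,
with arbitrary (possibly different) initial data. -/
structure IsSolutionPair (γ m : ℝ) (e : HilbertBasis ℕ ℝ H) (N : ℕ) (P : Measure Ω)
    (ℱ : Filtration ℝ≥0 mΩ) (β : ℕ → ℝ≥0 → Ω → ℝ) (b : ℕ → ℝ) (h : H)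
    (ξu ξv : ℝ → Ω → Phase) : Prop where
  usual : UsualConditions P ℱ
  brownian : IsBrownianSequence P ℱ β
  summable : Summable fun i => b i ^ 2
  solves_u : IsMildSolution γ P ℱ (wiener e b β) (fun s ω => h - nonlin m (ξu s ω).1) ξu
  solves_v : IsMildSolution γ P ℱ (wiener e b β)
    (fun s ω => h - nonlin m (ξv s ω).1
      - proj e N (nonlin m (ξu s ω).1 - nonlin m (ξv s ω).1)) ξv

end Stochastic

end WaveLine

end

open WaveLine

/-! The difference `w = u - v` sees neither `h` nor the noise: it is a mild solution of `ẅ + A w + γ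
ẇ = -(1 - P_N)(f(u) - f(v))`. Pathwise this needs an argument, because the two stochastic
convolutions agree almost surely only at each fixed time. Agreement on a countable dense set of
times and continuity of the remaining terms give it for all times at once
(`IsSolutionPair.ae_isDifferencePair`).

Let `E` be the energy of `w`, formed with `α = min (γ/4) (1/(2γ))`. Along the linear flow `E' ≤
-(3/2) α E` (`dissipation_le`), and a force of size at most `c ‖w‖₁` adds at most `c E`
(`dissipation_add_le`). Mild solutions are not differentiable, so the energy identity is proved on
the domain of the generator, extended to all data by density, and combined with variation of
constants (`IsWaveGroup.hasDerivAt_phaseNormSq_forced`). Both claims then reduce to choosing `c` and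
applying Grönwall; the spare `α/2` in the decay rate pays for the constant term in `c`.

For (1), `H¹ ⊂ L^∞` gives `c` of order `(‖u‖₁ + ‖v‖₁)^{2m}`. As `2m < 2`, Young's inequality bounds
it by `α/2` plus a multiple of `‖u‖₁² + ‖v‖₁²`.

For (2), `c` must be small uniformly over solutions. On `[-R, R)` the Hölder bound in `H¹` places
`f(u) - f(v)` close to a step function on a fixed mesh. Only finitely many mesh indicators occur, so
one `N` makes `1 - P_N` small on all of them. Outside, the weight `ψ` is at least `φ(R)/2` once the
time exceeds `φ(R)`, so `|u|` is at most `4/φ(R)` times the weighted norm. This is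
`exists_norm_tailProj_nonlin_sub_le_weighted`. Grönwall is then applied to `log E`, which allows an
infinite integral on the right. -/

namespace WaveLine

/-! ### The Sobolev space `H¹(ℝ)` -/

/-- The du Bois-Reymond lemma on the line. -/
lemma ae_const_of_integral_mul_deriv_eq_zero {f : ℝ → ℝ} (hf : LocallyIntegrable f)
    (h : ∀ φ : ℝ → ℝ, ContDiff ℝ (⊤ : ℕ∞) φ → HasCompactSupport φ → ∫ x, f x * deriv φ x = 0) :
    ∃ c : ℝ, f =ᵐ[volume] fun _ => c := by
  let ρ : ContDiffBump (0 : ℝ) := default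
  set r : ℝ → ℝ := ρ.normed volume with hr
  have r_smooth : ContDiff ℝ (⊤ : ℕ∞) r := ρ.contDiff_normed
  have r_supp : HasCompactSupport r := ρ.hasCompactSupport_normed
  have r_int : ∫ x, r x = 1 := ρ.integral_normed
  have hmul : ∀ φ : ℝ → ℝ, Continuous φ → HasCompactSupport φ →
      Integrable fun x => f x * φ x := fun φ hφ hc => by
    simpa [smul_eq_mul, mul_comm] using hf.integrable_smul_left_of_hasCompactSupport hφ hc
  -- Every test function `φ` equals `(∫ φ) r` plus a test function of mean zero. The latter is the
  -- derivative of a test function, which `f` annihilates, so the constant has to be the mean of `f`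
  -- against `r`.
  refine ⟨∫ x, f x * r x, ?_⟩
  refine ae_eq_of_integral_contDiff_smul_eq hf
    (continuous_const.locallyIntegrable) fun φ hφ hc => ?_
  set I : ℝ := ∫ x, φ x with hI
  set θ : ℝ → ℝ := fun x => φ x - I * r x with hθ
  have θ_smooth : ContDiff ℝ (⊤ : ℕ∞) θ := hφ.sub (contDiff_const.mul r_smooth)
  have θ_supp : HasCompactSupport θ := hc.sub r_supp.mul_left
  have θ_int : ∫ x, θ x = 0 := by
    rw [hθ, integral_sub (hφ.continuous.integrable_of_hasCompactSupport hc)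
      ((r_smooth.continuous.integrable_of_hasCompactSupport r_supp).const_mul I),
      integral_const_mul, r_int, hI]
    ring
  obtain ⟨R, hR, hθR⟩ := θ_supp.exists_pos_le_norm
  set Θ : ℝ → ℝ := fun x => ∫ t in (-R)..x, θ t with hΘ
  have Θ_deriv : ∀ x, HasDerivAt Θ (θ x) x := fun x =>
    intervalIntegral.integral_hasDerivAt_right (θ_smooth.continuous.intervalIntegrable _ _)
      (θ_smooth.continuous.stronglyMeasurableAtFilter _ _) θ_smooth.continuous.continuousAt
  have Θ_deriv' : deriv Θ = θ := funext fun x => (Θ_deriv x).deriv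
  have Θ_smooth : ContDiff ℝ (⊤ : ℕ∞) Θ := by
    rw [contDiff_infty_iff_deriv, Θ_deriv']
    exact ⟨fun x => (Θ_deriv x).differentiableAt, θ_smooth⟩
  have Θ_supp : HasCompactSupport Θ := by
    refine HasCompactSupport.intro (isCompact_Icc (a := -R) (b := R)) fun x hx => ?_
    rw [mem_Icc, not_and_or, not_le, not_le] at hx
    rcases hx with hx | hx
    · have : EqOn θ (fun _ => 0) (uIcc (-R) x) := fun t ht => by
        rw [uIcc_of_ge hx.le] at ht
        exact hθR t (by rw [Real.norm_eq_abs, le_abs]; right; linarith [ht.2])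
      rw [hΘ]
      simp [intervalIntegral.integral_congr this]
    · rw [← θ_int, hΘ]
      refine intervalIntegral.integral_eq_integral_of_support_subset fun t ht => ?_
      have : ¬ R ≤ ‖t‖ := fun h => ht (hθR t h)
      rw [Real.norm_eq_abs, not_le, abs_lt] at this
      exact ⟨this.1, by linarith [this.2]⟩
  have key := h Θ Θ_smooth Θ_supp
  rw [Θ_deriv'] at key
  have e : (fun x => f x * θ x) = fun x => f x * φ x - I * (f x * r x) := by
    funext x; simp only [hθ]; ring
  rw [e, integral_sub (hmul φ hφ.continuous hc) ((hmul r r_smooth.continuous r_supp).const_mul I),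
    integral_const_mul, sub_eq_zero] at key
  simp only [smul_eq_mul]
  rw [integral_mul_const, ← hI, ← key]
  exact integral_congr_ae (ae_of_all _ fun x => mul_comm _ _)

/-- The product rule for primitives of locally integrable functions. -/
lemma mul_sub_mul_eq_integral {F₁ F₂ g₁ g₂ : ℝ → ℝ} {a b : ℝ}
    (hg₁ : IntervalIntegrable g₁ volume a b) (hg₂ : IntervalIntegrable g₂ volume a b)
    (h₁ : ∀ x, F₁ x - F₁ a = ∫ t in a..x, g₁ t) (h₂ : ∀ x, F₂ x - F₂ a = ∫ t in a..x, g₂ t) :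
    F₁ b * F₂ b - F₁ a * F₂ a = ∫ x in a..b, (g₁ x * F₂ x + F₁ x * g₂ x) := by
  have ac : ∀ {F g : ℝ → ℝ}, IntervalIntegrable g volume a b →
      (∀ x, F x - F a = ∫ t in a..x, g t) → AbsolutelyContinuousOnInterval F a b ∧
        ∀ᵐ x, x ∈ uIcc a b → HasDerivAt F (g x) x := by
    intro F g hg h
    have hF : F = fun x => F a + ∫ t in a..x, g t := funext fun x => by rw [← h x]; ring
    constructor
    · rw [hF]
      exact (contDiffOn_const.absolutelyContinuousOnInterval).fun_add
        (hg.absolutelyContinuousOnInterval_intervalIntegral left_mem_uIcc)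
    · filter_upwards [hg.ae_hasDerivAt_integral] with x hx hxm
      rw [hF]
      exact (hx hxm a left_mem_uIcc).const_add _
  obtain ⟨ac₁, d₁⟩ := ac hg₁ h₁
  obtain ⟨ac₂, d₂⟩ := ac hg₂ h₂
  rw [← ac₁.integral_deriv_mul_eq_sub ac₂]
  refine intervalIntegral.integral_congr_ae ?_
  filter_upwards [d₁, d₂] with x h₁ h₂ hx
  rw [(h₁ (uIoc_subset_uIcc hx)).deriv, (h₂ (uIoc_subset_uIcc hx)).deriv]

lemma H.locallyIntegrable (u : H) : LocallyIntegrable (u : ℝ → ℝ) volume :=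
  (Lp.memLp u).locallyIntegrable (by norm_num)

lemma H.intervalIntegrable (u : H) (a b : ℝ) : IntervalIntegrable (u : ℝ → ℝ) volume a b :=
  ((H.locallyIntegrable u).integrableOn_isCompact isCompact_uIcc).intervalIntegrable

lemma H1.isWeakDeriv (u : H1) : IsWeakDeriv u.toL2 u.dx := u.2

/-- Every element of `H¹(ℝ)` has a continuous representative, a primitive of its derivative. -/
lemma H1.exists_rep (u : H1) : ∃ r : ℝ → ℝ, u.toL2 =ᵐ[volume] r ∧
    ∀ a b, r b - r a = ∫ x in a..b, u.dx x := by
  set G : ℝ → ℝ := fun x => ∫ t in (0 : ℝ)..x, u.dx t with hG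
  have hGd : ∀ a b, G b - G a = ∫ x in a..b, u.dx x := fun a b =>
    intervalIntegral.integral_interval_sub_left (H.intervalIntegrable _ _ _)
      (H.intervalIntegrable _ _ _)
  have hGc : Continuous G := intervalIntegral.continuous_primitive (H.intervalIntegrable _) 0
  -- The primitive `G` of `u.dx` has the same weak derivative as `u`, so `u - G` is constant.
  obtain ⟨c, hc⟩ := ae_const_of_integral_mul_deriv_eq_zero
    (f := fun x => u.toL2 x - G x) ((H.locallyIntegrable _).sub hGc.locallyIntegrable)
    fun φ hφ hs => by
      have hd := continuous_deriv_test hφ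
      have i₁ := integrable_mul_test u.toL2 hd hs.deriv
      have i₂ : Integrable fun x => G x * deriv φ x :=
        (hGc.mul hd).integrable_of_hasCompactSupport hs.deriv.mul_left
      have i₃ := integrable_mul_test u.dx hφ.continuous hs
      obtain ⟨R, hR, hφR⟩ := hs.exists_pos_le_norm
      -- The endpoints are `±(R+1)` rather than `±R` because the support, possibly touching `-R`,
      -- must lie in a half-open interval.
      have key := mul_sub_mul_eq_integral (F₁ := G) (F₂ := φ) (g₁ := u.dx) (g₂ := deriv φ)
        (H.intervalIntegrable u.dx (-(R+1)) (R+1)) (hd.intervalIntegrable _ _) (fun x => hGd _ x)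
        (fun x => (intervalIntegral.integral_deriv_eq_sub
          (fun y _ => (hφ.differentiable (by simp)).differentiableAt)
          (hd.intervalIntegrable _ _)).symm)
      rw [hφR (R+1) (by rw [Real.norm_eq_abs, le_abs]; left; linarith),
        hφR (-(R+1)) (by rw [Real.norm_eq_abs, le_abs]; right; linarith),
        intervalIntegral.integral_eq_integral_of_support_subset, integral_add i₃ i₂] at key
      · simp_rw [sub_mul]
        rw [integral_sub i₁ i₂, u.isWeakDeriv φ hφ hs]
        linarith
      · intro x hx
        have h1 : ¬ R ≤ ‖x‖ ∨ x ∈ tsupport φ := by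
          by_contra hcon
          push Not at hcon
          apply hx
          have : deriv φ x = 0 := by
            by_contra h0
            exact hcon.2 (support_deriv_subset h0)
          simp [this, hφR x hcon.1]
        have h2 : |x| ≤ R := by
          rcases h1 with h1 | h1
          · exact (not_le.mp h1).le
          · have : tsupport φ ⊆ Metric.closedBall 0 R := by
              refine closure_minimal (fun y hy => ?_) Metric.isClosed_closedBall
              rw [mem_closedBall_zero_iff]
              by_contra h3
              exact hy (hφR y (not_le.mp h3).le)
            simpa using this h1
        rw [abs_le] at h2
        exact ⟨by linarith [h2.1], by linarith [h2.2]⟩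
  refine ⟨fun x => c + G x, ?_, fun a b => by rw [← hGd]; ring⟩
  filter_upwards [hc] with x hx
  rw [← hx]; ring

/-- The continuous representative of an element of `H¹(ℝ)`. -/
noncomputable def H1.rep (u : H1) : ℝ → ℝ := u.exists_rep.choose

lemma H1.toL2_ae_eq_rep (u : H1) : u.toL2 =ᵐ[volume] u.rep := u.exists_rep.choose_spec.1

lemma H1.rep_sub_rep (u : H1) (a b : ℝ) : u.rep b - u.rep a = ∫ x in a..b, u.dx x :=
  u.exists_rep.choose_spec.2 a b

lemma H1.continuous_rep (u : H1) : Continuous u.rep := by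
  have : u.rep = fun x => u.rep 0 + ∫ t in (0 : ℝ)..x, u.dx t :=
    funext fun x => by rw [← u.rep_sub_rep]; ring
  rw [this]
  exact continuous_const.add
    (intervalIntegral.continuous_primitive (H.intervalIntegrable _) 0)

lemma H1.toL2_sub (u v : H1) : (u - v).toL2 = u.toL2 - v.toL2 := rfl
lemma H1.toL2_add (u v : H1) : (u + v).toL2 = u.toL2 + v.toL2 := rfl
lemma H1.toL2_smul (c : ℝ) (v : H1) : (c • v).toL2 = c • v.toL2 := rfl
lemma H1.dx_add (u v : H1) : (u + v).dx = u.dx + v.dx := rfl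
lemma H1.dx_smul (c : ℝ) (v : H1) : (c • v).dx = c • v.dx := rfl

lemma H1.rep_sub (u v : H1) (x : ℝ) : (u - v).rep x = u.rep x - v.rep x := by
  have : (u - v).rep =ᵐ[volume] fun x => u.rep x - v.rep x := by
    have h := Lp.coeFn_sub u.toL2 v.toL2
    rw [← H1.toL2_sub] at h
    filter_upwards [h, u.toL2_ae_eq_rep, v.toL2_ae_eq_rep, (u - v).toL2_ae_eq_rep]
      with x h1 h2 h3 h4
    rw [← h2, ← h3, ← h4, h1, Pi.sub_apply]
  exact congrFun (((u - v).continuous_rep.ae_eq_iff_eq volume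
    (u.continuous_rep.sub v.continuous_rep)).1 this) x

lemma H1.inner_eq (u v : H1) : ⟪u, v⟫_ℝ = ⟪u.toL2, v.toL2⟫_ℝ + ⟪u.dx, v.dx⟫_ℝ :=
  WithLp.prod_inner_apply _ _

lemma H1.norm_sq_eq (u : H1) : ‖u‖ ^ 2 = ‖u.toL2‖ ^ 2 + ‖u.dx‖ ^ 2 := by
  rw [← real_inner_self_eq_norm_sq, ← real_inner_self_eq_norm_sq, ← real_inner_self_eq_norm_sq,
    H1.inner_eq]

lemma H1.norm_toL2_le (u : H1) : ‖u.toL2‖ ≤ ‖u‖ :=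
  abs_le_of_sq_le_sq' (by rw [u.norm_sq_eq]; nlinarith [sq_nonneg ‖u.dx‖]) (norm_nonneg _) |>.2

lemma H1.norm_dx_le (u : H1) : ‖u.dx‖ ≤ ‖u‖ :=
  abs_le_of_sq_le_sq' (by rw [u.norm_sq_eq]; nlinarith [sq_nonneg ‖u.toL2‖]) (norm_nonneg _) |>.2

/-- The Cauchy-Schwarz inequality on an interval. -/
lemma H.abs_integral_le (g : H) {a b : ℝ} (hab : a ≤ b) :
    |∫ x in a..b, g x| ≤ Real.sqrt (b - a) * ‖g‖ := by
  have hms : MeasurableSet (Ioc a b) := measurableSet_Ioc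
  have hfin : volume (Ioc a b) ≠ ∞ := by simp
  have := L2.inner_indicatorConstLp_one (𝕜 := ℝ) hms hfin g
  rw [intervalIntegral.integral_of_le hab, ← this]
  refine (abs_real_inner_le_norm _ _).trans (le_of_eq ?_)
  rw [norm_indicatorConstLp (by norm_num) (by norm_num)]
  simp [Real.sqrt_eq_rpow, hab]

/-- The Hölder estimate for functions of `H¹(ℝ)`. -/
lemma H1.abs_rep_sub_le (u : H1) (x y : ℝ) :
    |u.rep x - u.rep y| ≤ Real.sqrt |x - y| * ‖u‖ := by
  wlog h : y ≤ x generalizing x y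
  · rw [abs_sub_comm, abs_sub_comm x]; exact this y x (le_of_not_ge h)
  rw [u.rep_sub_rep, abs_of_nonneg (sub_nonneg.2 h)]
  exact (H.abs_integral_le _ h).trans
    (mul_le_mul_of_nonneg_left u.norm_dx_le (Real.sqrt_nonneg _))

/-- The embedding `H¹(ℝ) ⊂ L^∞(ℝ)`. -/
lemma H1.abs_rep_le (u : H1) (x : ℝ) : |u.rep x| ≤ 2 * ‖u‖ := by
  -- The value at `x` is the mean over `[x, x+1]` plus the mean deviation from it. Each is at most
  -- `‖u‖`, hence the constant 2.
  have h1 : |∫ y in x..(x + 1), u.rep y| ≤ ‖u‖ := by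
    have : ∫ y in x..(x + 1), u.rep y = ∫ y in x..(x + 1), u.toL2 y :=
      intervalIntegral.integral_congr_ae (u.toL2_ae_eq_rep.symm.mono fun y hy _ => hy)
    rw [this]
    refine (H.abs_integral_le u.toL2 (by linarith)).trans ?_
    simpa using u.norm_toL2_le
  have h2 : |∫ y in x..(x + 1), (u.rep x - u.rep y)| ≤ ‖u‖ := by
    have := intervalIntegral.norm_integral_le_of_norm_le_const (a := x) (b := x + 1) (C := ‖u‖)
      (f := fun y => u.rep x - u.rep y) fun y hy => by
        rw [uIoc_of_le (by linarith)] at hy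
        rw [Real.norm_eq_abs]
        refine (u.abs_rep_sub_le x y).trans (mul_le_of_le_one_left (norm_nonneg _) ?_)
        rw [Real.sqrt_le_one, abs_sub_comm, abs_of_pos (by linarith [hy.1])]
        linarith [hy.2]
    simpa using this
  rw [intervalIntegral.integral_sub (by simp) (u.continuous_rep.intervalIntegrable _ _)] at h2
  simp only [intervalIntegral.integral_const, add_sub_cancel_left, smul_eq_mul, one_mul] at h2
  rw [abs_le] at *
  constructor <;> linarith [h1.1, h1.2, h2.1, h2.2]

/-- Integration by parts in `H¹(ℝ)`. -/
lemma H1.inner_dx (u v : H1) : ⟪u.dx, v.toL2⟫_ℝ = -⟪u.toL2, v.dx⟫_ℝ := by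
  have e1 : ⟪u.dx, v.toL2⟫_ℝ = ∫ x, u.dx x * v.rep x := by
    rw [L2.inner_def]
    refine integral_congr_ae (v.toL2_ae_eq_rep.mono fun x hx => ?_)
    simp [hx, mul_comm]
  have e2 : ⟪u.toL2, v.dx⟫_ℝ = ∫ x, u.rep x * v.dx x := by
    rw [L2.inner_def]
    refine integral_congr_ae (u.toL2_ae_eq_rep.mono fun x hx => ?_)
    simp [hx, mul_comm]
  have i1 : Integrable fun x => u.dx x * v.rep x :=
    ((Lp.memLp u.dx).integrable_mul (Lp.memLp v.toL2)).congr
      (v.toL2_ae_eq_rep.mono fun x hx => by simp [hx])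
  have i2 : Integrable fun x => u.rep x * v.dx x :=
    ((Lp.memLp u.toL2).integrable_mul (Lp.memLp v.dx)).congr
      (u.toL2_ae_eq_rep.mono fun x hx => by simp [hx])
  have i3 : Integrable fun x => u.rep x * v.rep x :=
    ((Lp.memLp u.toL2).integrable_mul (Lp.memLp v.toL2)).congr (by
      filter_upwards [u.toL2_ae_eq_rep, v.toL2_ae_eq_rep] with x hx hy
      simp [hx, hy])
  set p : ℝ → ℝ := fun x => u.rep x * v.rep x with hp
  set J : ℝ := ∫ x, (u.dx x * v.rep x + u.rep x * v.dx x) with hJ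
  have hprod : ∀ a b, p b - p a = ∫ x in a..b, (u.dx x * v.rep x + u.rep x * v.dx x) :=
    fun a b => mul_sub_mul_eq_integral (H.intervalIntegrable _ _ _) (H.intervalIntegrable _ _ _)
      (fun x => u.rep_sub_rep a x) (fun x => v.rep_sub_rep a x)
  have hlim : Tendsto (fun x : ℝ => p x - p (-x)) atTop (𝓝 J) := by
    simp_rw [hprod]
    exact intervalIntegral_tendsto_integral (i1.add i2) tendsto_neg_atTop_atBot tendsto_id
  -- The function `p x - p (-x)` is integrable and converges to `J` at infinity, which forces `J =
  -- 0`.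
  have hJ0 : J = 0 := by
    have hq : Integrable fun x => p x - p (-x) := i3.sub i3.comp_neg
    have := hq.norm
    by_contra hne
    have hev : ∀ᶠ x in atTop, |J| / 2 ≤ ‖p x - p (-x)‖ :=
      (hlim.norm).eventually_const_le (by simpa using hne)
    obtain ⟨a, ha⟩ := eventually_atTop.1 hev
    have hc : IntegrableOn (fun _ : ℝ => |J| / 2) (Ici a) :=
      this.integrableOn.mono' (by fun_prop) ((ae_restrict_iff' measurableSet_Ici).2
        (ae_of_all _ fun x hx => by
          rw [Real.norm_of_nonneg (by positivity)]; exact ha x hx))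
    rw [integrableOn_const_iff] at hc
    rcases hc with hc | hc
    · simp [hne] at hc
    · simp at hc
  rw [e1, e2, eq_neg_iff_add_eq_zero, ← integral_add i1 i2]
  exact hJ0

/-! ### The power nonlinearity -/

/-- The scalar function `x ↦ |x|^{2m} x`. -/
noncomputable def signedPow (m x : ℝ) : ℝ := |x| ^ (2 * m) * x

lemma hasDerivAt_signedPow {m : ℝ} (hm : 0 < m) (x : ℝ) :
    HasDerivAt (signedPow m) ((2 * m + 1) * |x| ^ (2 * m)) x := by
  have hpos : ∀ y : ℝ, 0 < y → HasDerivAt (fun z : ℝ => z ^ (2 * m) * z)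
      ((2 * m + 1) * y ^ (2 * m)) y := fun y hy => by
    have h := (Real.hasDerivAt_rpow_const (x := y) (p := 2 * m) (Or.inl hy.ne')).mul
      (hasDerivAt_id y)
    refine h.congr_deriv ?_
    rw [Real.rpow_sub_one hy.ne']
    simp only [id]
    field_simp
  rcases lt_trichotomy x 0 with hx | hx | hx
  · have h := ((hpos (-x) (by linarith)).comp x (hasDerivAt_neg x)).neg
    rw [abs_of_neg hx]
    refine (h.congr_of_eventuallyEq ?_).congr_deriv (by ring)
    filter_upwards [Iio_mem_nhds hx] with y hy
    simp [signedPow, abs_of_neg (mem_Iio.1 hy)]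
  · subst hx
    rw [hasDerivAt_iff_tendsto_slope]
    have : Tendsto (fun y : ℝ => |y| ^ (2 * m)) (𝓝[≠] 0) (𝓝 (|0| ^ (2 * m))) :=
      ((continuous_abs.rpow_const fun _ => Or.inr (by positivity)).tendsto 0).mono_left
        nhdsWithin_le_nhds
    rw [abs_zero, Real.zero_rpow (by positivity)] at *
    rw [mul_zero]
    refine this.congr' ?_
    filter_upwards [self_mem_nhdsWithin] with y hy
    have hy : y ≠ 0 := hy
    simp [slope_def_field, signedPow, hy]
  · rw [abs_of_pos hx]
    refine (hpos x hx).congr_of_eventuallyEq ?_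
    filter_upwards [Ioi_mem_nhds hx] with y hy
    simp [signedPow, abs_of_pos (mem_Ioi.1 hy)]

lemma continuous_signedPow {m : ℝ} (hm : 0 < m) : Continuous (signedPow m) :=
  continuous_iff_continuousAt.2 fun x => (hasDerivAt_signedPow hm x).continuousAt

/-- Hölder continuity of the power `|x|^{2m}` on bounded sets. -/
lemma abs_rpow_sub_rpow_le {m x y M ρ : ℝ} (hm0 : 0 < m) (hm1 : m ≤ 1) (hx : |x| ≤ M)
    (hy : |y| ≤ M) (hρ : |x - y| ≤ ρ) :
    |(|x| ^ (2 * m) - |y| ^ (2 * m))| ≤ 2 * M ^ m * ρ ^ m := by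
  -- The exponent `2m` may exceed 1, but `m` does not. The difference of squares factors through
  -- `|x|^m - |y|^m`, and `t ↦ t^m` is subadditive.
  have hsq : ∀ z : ℝ, |z| ^ (2 * m) = |z| ^ m * |z| ^ m := fun z => by
    rw [two_mul, Real.rpow_add_of_nonneg (abs_nonneg _) hm0.le hm0.le]
  have hρ0 : 0 ≤ ρ := (abs_nonneg _).trans hρ
  have hone : ∀ z w : ℝ, |z - w| ≤ ρ → |z| ^ m - |w| ^ m ≤ ρ ^ m := fun z w h => by
    have h1 : |z| ≤ |w| + ρ := by linarith [abs_sub_abs_le_abs_sub z w]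
    have h2 : |z| ^ m ≤ (|w| + ρ) ^ m := Real.rpow_le_rpow (abs_nonneg _) h1 hm0.le
    linarith [Real.rpow_add_le_add_rpow (abs_nonneg w) hρ0 hm0.le hm1]
  have hd : |(|x| ^ m - |y| ^ m)| ≤ ρ ^ m :=
    abs_le.2 ⟨by linarith [hone y x (by rwa [abs_sub_comm])], hone x y hρ⟩
  have hxM : |x| ^ m ≤ M ^ m := Real.rpow_le_rpow (abs_nonneg _) hx hm0.le
  have hyM : |y| ^ m ≤ M ^ m := Real.rpow_le_rpow (abs_nonneg _) hy hm0.le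
  have hx0 : 0 ≤ |x| ^ m := by positivity
  have hy0 : 0 ≤ |y| ^ m := by positivity
  rw [hsq, hsq, show |x| ^ m * |x| ^ m - |y| ^ m * |y| ^ m =
    (|x| ^ m + |y| ^ m) * (|x| ^ m - |y| ^ m) by ring, abs_mul,
    abs_of_nonneg (add_nonneg hx0 hy0)]
  exact mul_le_mul (by linarith) hd (abs_nonneg _) (by linarith)

lemma abs_segment_le {a b M θ : ℝ} (ha : |a| ≤ M) (hb : |b| ≤ M) (h0 : 0 ≤ θ) (h1 : θ ≤ 1) :
    |b + θ * (a - b)| ≤ M := by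
  rw [abs_le] at *
  constructor <;> nlinarith

lemma hasDerivAt_signedPow_segment {m : ℝ} (hm : 0 < m) (a b θ : ℝ) :
    HasDerivAt (fun θ : ℝ => signedPow m (b + θ * (a - b)))
      ((2 * m + 1) * |b + θ * (a - b)| ^ (2 * m) * (a - b)) θ := by
  have h := (((hasDerivAt_id θ).mul_const (a - b)).const_add b)
  exact ((hasDerivAt_signedPow hm _).comp θ h).congr_deriv (by simp only [id]; ring)

lemma abs_signedPow_sub_le {m a b M : ℝ} (hm : 0 < m) (ha : |a| ≤ M) (hb : |b| ≤ M) :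
    |signedPow m a - signedPow m b| ≤ (2 * m + 1) * M ^ (2 * m) * |a - b| := by
  have h := norm_image_sub_le_of_norm_deriv_le_segment_01'
    (f := fun θ : ℝ => signedPow m (b + θ * (a - b))) (C := (2 * m + 1) * M ^ (2 * m) * |a - b|)
    (fun θ _ => (hasDerivAt_signedPow_segment hm a b θ).hasDerivWithinAt) fun θ hθ => by
      rw [Real.norm_eq_abs, abs_mul, abs_mul, abs_of_pos (by positivity : 0 < 2 * m + 1),
        abs_of_nonneg (by positivity : 0 ≤ |b + θ * (a - b)| ^ (2 * m))]
      gcongr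
      exact abs_segment_le ha hb hθ.1 hθ.2.le
  simpa using h

/-- The increments of the difference of two values of the nonlinearity. -/
lemma abs_signedPow_sub_sub_le {m a b c d M ρ : ℝ} (hm0 : 0 < m) (hm1 : m ≤ 1) (ha : |a| ≤ M)
    (hb : |b| ≤ M) (hc : |c| ≤ M) (hd : |d| ≤ M) (hac : |a - c| ≤ ρ) (hbd : |b - d| ≤ ρ) :
    |signedPow m a - signedPow m b - (signedPow m c - signedPow m d)| ≤
      (2 * m + 1) * (2 * M ^ m * ρ ^ m * |a - b| + M ^ (2 * m) * |a - b - (c - d)|) := by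
  have h := norm_image_sub_le_of_norm_deriv_le_segment_01'
    (f := fun θ : ℝ => signedPow m (b + θ * (a - b)) - signedPow m (d + θ * (c - d)))
    (C := (2 * m + 1) * (2 * M ^ m * ρ ^ m * |a - b| + M ^ (2 * m) * |a - b - (c - d)|))
    (fun θ _ => ((hasDerivAt_signedPow_segment hm0 a b θ).sub
      (hasDerivAt_signedPow_segment hm0 c d θ)).hasDerivWithinAt) fun θ hθ => by
      set A := b + θ * (a - b)
      set B := d + θ * (c - d)
      have hA : |A| ≤ M := abs_segment_le ha hb hθ.1 hθ.2.le
      have hB : |B| ≤ M := abs_segment_le hc hd hθ.1 hθ.2.le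
      have hAB : |A - B| ≤ ρ := by
        have : A - B = (b - d) + θ * ((a - c) - (b - d)) := by simp only [A, B]; ring
        rw [this]
        exact abs_segment_le hac hbd hθ.1 hθ.2.le
      have e : (2 * m + 1) * |A| ^ (2 * m) * (a - b) - (2 * m + 1) * |B| ^ (2 * m) * (c - d) =
          (2 * m + 1) * ((|A| ^ (2 * m) - |B| ^ (2 * m)) * (a - b)
            + |B| ^ (2 * m) * (a - b - (c - d))) := by ring
      rw [Real.norm_eq_abs, e, abs_mul, abs_of_pos (by positivity : 0 < 2 * m + 1)]
      refine mul_le_mul_of_nonneg_left ((abs_add_le _ _).trans (add_le_add ?_ ?_)) (by positivity)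
      · rw [abs_mul]
        exact mul_le_mul_of_nonneg_right (abs_rpow_sub_rpow_le hm0 hm1 hA hB hAB) (abs_nonneg _)
      · rw [abs_mul, abs_of_nonneg (by positivity)]
        gcongr
  rw [sub_sub_sub_comm]
  simpa using h

/-- Sufficient when the power already carries a small prefactor; otherwise `exists_rpow_two_mul_le`
makes the additive constant small. -/
lemma rpow_two_mul_le_one_add_sq {m x : ℝ} (hm0 : 0 < m) (hm1 : m ≤ 1) (hx : 0 ≤ x) :
    x ^ (2 * m) ≤ 1 + x ^ 2 := by
  rcases le_total x 1 with h | h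
  · have := Real.rpow_le_one hx h (by positivity : 0 ≤ 2 * m)
    nlinarith [sq_nonneg x]
  · have := Real.rpow_le_rpow_of_exponent_le h (by linarith : 2 * m ≤ 2)
    rw [Real.rpow_two] at this
    linarith

/-- Young's inequality for the subquadratic power `x^{2m}`. -/
lemma exists_rpow_two_mul_le {m κ : ℝ} (hm0 : 0 < m) (hm1 : m < 1) (hκ : 0 < κ) :
    ∃ C : ℝ, 0 < C ∧ ∀ x : ℝ, 0 ≤ x → x ^ (2 * m) ≤ κ + C * x ^ 2 := by
  -- The threshold at which `x^{2m} = κ`. Beyond it, `x^{2m} = x^{2m-2} x²` with a nonpositive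
  -- exponent `2m - 2`; this is where `m < 1` enters.
  set x₀ : ℝ := κ ^ (1 / (2 * m)) with hx₀
  have hx₀pos : 0 < x₀ := Real.rpow_pos_of_pos hκ _
  have hx₀κ : x₀ ^ (2 * m) = κ := by
    rw [hx₀, ← Real.rpow_mul hκ.le, one_div, inv_mul_cancel₀ (by positivity), Real.rpow_one]
  refine ⟨x₀ ^ (2 * m - 2), Real.rpow_pos_of_pos hx₀pos _, fun x hx => ?_⟩
  have hC : 0 < x₀ ^ (2 * m - 2) := Real.rpow_pos_of_pos hx₀pos _
  rcases le_total x x₀ with h | h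
  · have := Real.rpow_le_rpow hx h (by positivity : 0 ≤ 2 * m)
    rw [hx₀κ] at this
    nlinarith [mul_nonneg hC.le (sq_nonneg x)]
  · have hxpos : 0 < x := hx₀pos.trans_le h
    have e : x ^ (2 * m) = x ^ (2 * m - 2) * x ^ 2 := by
      rw [← Real.rpow_two, ← Real.rpow_add hxpos]; ring_nf
    have : x ^ (2 * m - 2) ≤ x₀ ^ (2 * m - 2) :=
      Real.rpow_le_rpow_of_nonpos hx₀pos h (by linarith)
    rw [e]
    nlinarith [mul_le_mul_of_nonneg_right this (sq_nonneg x)]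

/-- Functions in `H¹` are bounded, so the power is dominated by a multiple of `u`. Hence the default
value in `nonlin` is never taken. -/
lemma memLp_signedPow_toL2 {m : ℝ} (hm : 0 < m) (u : H1) :
    MemLp (fun x => |u.toL2 x| ^ (2 * m) * u.toL2 x) 2 volume := by
  refine (Lp.memLp u.toL2).of_le_mul (c := (2 * ‖u‖) ^ (2 * m)) ?_ ?_
  · exact (continuous_signedPow hm).comp_aestronglyMeasurable (Lp.aestronglyMeasurable u.toL2)
  · filter_upwards [u.toL2_ae_eq_rep] with x hx
    rw [norm_mul, Real.norm_of_nonneg (by positivity), hx]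
    gcongr
    exact u.abs_rep_le x

lemma nonlin_ae_eq {m : ℝ} (hm : 0 < m) (u : H1) :
    nonlin m u =ᵐ[volume] fun x => signedPow m (u.rep x) := by
  rw [nonlin, dif_pos (memLp_signedPow_toL2 hm u)]
  filter_upwards [(memLp_signedPow_toL2 hm u).coeFn_toLp, u.toL2_ae_eq_rep] with x h1 h2
  rw [h1, h2, signedPow]

lemma nonlin_sub_ae_eq {m : ℝ} (hm : 0 < m) (u v : H1) :
    (nonlin m u - nonlin m v : H) =ᵐ[volume]
      fun x => signedPow m (u.rep x) - signedPow m (v.rep x) := by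
  filter_upwards [Lp.coeFn_sub (nonlin m u) (nonlin m v), nonlin_ae_eq hm u, nonlin_ae_eq hm v]
    with x h1 h2 h3
  rw [h1, Pi.sub_apply, h2, h3]

lemma norm_nonlin_sub_le {m : ℝ} (hm : 0 < m) (u v : H1) :
    ‖nonlin m u - nonlin m v‖ ≤
      (2 * m + 1) * (2 * (‖u‖ + ‖v‖)) ^ (2 * m) * ‖u - v‖ := by
  set K := (2 * m + 1) * (2 * (‖u‖ + ‖v‖)) ^ (2 * m)
  have hK : 0 ≤ K := by positivity
  refine (Lp.norm_le_mul_norm_of_ae_le_mul (g := (u - v).toL2) (c := K) ?_).trans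
    (mul_le_mul_of_nonneg_left (u - v).norm_toL2_le hK)
  filter_upwards [nonlin_sub_ae_eq hm u v, (u - v).toL2_ae_eq_rep] with x h1 h2
  rw [h1, h2, H1.rep_sub]
  refine abs_signedPow_sub_le hm ((u.abs_rep_le x).trans ?_) ((v.abs_rep_le x).trans ?_)
  · linarith [norm_nonneg v]
  · linarith [norm_nonneg u]

/-- Makes the force continuous in time along continuous paths, so that the Duhamel integrals are
genuine and the energy is continuously differentiable. -/
lemma continuous_nonlin {m : ℝ} (hm : 0 < m) : Continuous (nonlin m) := by
  rw [continuous_iff_continuousAt]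
  intro v
  rw [ContinuousAt, tendsto_iff_norm_sub_tendsto_zero]
  refine squeeze_zero (fun _ => norm_nonneg _) (fun u => norm_nonlin_sub_le hm u v) ?_
  have h1 : Continuous fun u : H1 => (2 * m + 1) * (2 * (‖u‖ + ‖v‖)) ^ (2 * m) * ‖u - v‖ := by
    refine (continuous_const.mul (Continuous.rpow_const (by fun_prop) fun _ => Or.inr
      (by positivity))).mul (by fun_prop)
  simpa using h1.tendsto v

/-! ### The projections `1 - P_N` -/

/-- The complementary projection `1 - P_N`. -/
noncomputable def tailProj (e : HilbertBasis ℕ ℝ H) (N : ℕ) : H →L[ℝ] H :=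
  ContinuousLinearMap.id ℝ H - ∑ i ∈ Finset.range N, (innerSL ℝ (e i)).smulRight (e i)

lemma tailProj_apply (e : HilbertBasis ℕ ℝ H) (N : ℕ) (x : H) :
    tailProj e N x = x - proj e N x := by
  simp [tailProj, proj]

lemma norm_tailProj_apply_le (e : HilbertBasis ℕ ℝ H) (N : ℕ) (x : H) :
    ‖tailProj e N x‖ ≤ ‖x‖ := by
  have h1 : ⟪x, proj e N x⟫_ℝ = ∑ i ∈ Finset.range N, ⟪e i, x⟫_ℝ ^ 2 := by
    rw [proj, inner_sum]
    refine Finset.sum_congr rfl fun i _ => ?_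
    rw [real_inner_smul_right, real_inner_comm, sq]
  have h2 : ⟪proj e N x, proj e N x⟫_ℝ = ∑ i ∈ Finset.range N, ⟪e i, x⟫_ℝ ^ 2 := by
    rw [proj, e.orthonormal.inner_sum]
    exact Finset.sum_congr rfl fun i _ => by simp [sq]
  refine abs_le_of_sq_le_sq' ?_ (norm_nonneg _) |>.2
  rw [tailProj_apply, norm_sub_sq_real, h1, ← real_inner_self_eq_norm_sq (proj e N x), h2]
  have : 0 ≤ ∑ i ∈ Finset.range N, ⟪e i, x⟫_ℝ ^ 2 := Finset.sum_nonneg fun _ _ => sq_nonneg _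
  linarith

lemma tendsto_tailProj (e : HilbertBasis ℕ ℝ H) (x : H) :
    Tendsto (fun N => ‖tailProj e N x‖) atTop (𝓝 0) := by
  have h := (e.hasSum_repr x).tendsto_sum_nat
  have h2 : Tendsto (fun N => x - proj e N x) atTop (𝓝 (x - x)) := by
    refine tendsto_const_nhds.sub (h.congr fun N => ?_)
    simp [proj, HilbertBasis.repr_apply_apply]
  simp_rw [tailProj_apply]
  simpa using h2.norm

/-! ### Step functions -/

/-- The mesh interval `[j/n, (j+1)/n)` as an element of `L²`. -/
noncomputable def meshIndicator (n : ℕ) (j : ℤ) : H :=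
  indicatorConstLp 2 (measurableSet_Ico (a := (j : ℝ) / n) (b := (j + 1 : ℝ) / n)) (by simp) (1 : ℝ)

/-- The step function with values `c j` on the mesh intervals of `[-R, R)`. -/
noncomputable def stepFun (R n : ℕ) (c : ℤ → ℝ) : H :=
  ∑ j ∈ Finset.Ico (-(R * n : ℤ)) (R * n), c j • meshIndicator n j

/-- Since `R` is an integer, the cells with `-R n ≤ j < R n` tile `[-R, R)` exactly, and `x` lies in
the cell of index `⌊x n⌋`. -/
lemma stepFun_ae_eq {R n : ℕ} (hn : 0 < n) (c : ℤ → ℝ) :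
    stepFun R n c =ᵐ[volume] (Ico (-R : ℝ) R).indicator fun x => c ⌊x * n⌋ := by
  have h1 : stepFun R n c =ᵐ[volume]
      fun x => ∑ j ∈ Finset.Ico (-(R * n : ℤ)) (R * n), c j * meshIndicator n j x := by
    rw [stepFun]
    generalize Finset.Ico (-(R * n : ℤ)) (R * n) = s
    induction s using Finset.induction_on with
    | empty =>
      filter_upwards [Lp.coeFn_zero ℝ 2 (volume : Measure ℝ)] with x hx
      simpa only [Finset.sum_empty, Pi.zero_apply] using hx
    | insert a s ha ih =>
      rw [Finset.sum_insert ha]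
      filter_upwards [Lp.coeFn_add (c a • meshIndicator n a) (∑ j ∈ s, c j • meshIndicator n j),
        Lp.coeFn_smul (c a) (meshIndicator n a), ih] with x h1 h2 h3
      rw [h1, Pi.add_apply, h2, h3, Finset.sum_insert ha, Pi.smul_apply, smul_eq_mul]
  have h2 : ∀ᵐ x, ∀ j, meshIndicator n j x =
      (Ico ((j : ℝ) / n) ((j + 1 : ℝ) / n)).indicator (fun _ => (1 : ℝ)) x :=
    ae_all_iff.2 fun j => indicatorConstLp_coeFn
  filter_upwards [h1, h2] with x h1 h2
  have hn' : (0 : ℝ) < n := by exact_mod_cast hn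
  have h3 : ∀ j : ℤ, meshIndicator n j x = if ⌊x * n⌋ = j then 1 else 0 := fun j => by
    rw [h2 j, indicator_apply]
    congr 1
    rw [mem_Ico, div_le_iff₀ hn', lt_div_iff₀ hn', Int.floor_eq_iff]
  rw [h1]
  simp_rw [h3]
  simp only [mul_ite, mul_one, mul_zero, Finset.sum_ite_eq, Finset.mem_Ico, indicator_apply]
  congr 1
  rw [Int.le_floor, Int.floor_lt, mem_Ico]
  push_cast
  rw [← neg_mul, mul_le_mul_iff_left₀ hn', mul_lt_mul_iff_left₀ hn']

/-- The nonlinear difference is approximated by the step function through its values at the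
mesh points, up to the tails. -/
lemma norm_nonlin_sub_sub_stepFun_le {m : ℝ} (hm0 : 0 < m) (hm1 : m < 1) {R n : ℕ} (hn : 0 < n)
    (u v : H1) {B : ℝ} (hu : ∀ x : ℝ, R ≤ |x| → |u.rep x| ≤ B) (hv : ∀ x : ℝ, R ≤ |x| → |v.rep x| ≤ B) :
    ‖nonlin m u - nonlin m v - stepFun R n
        (fun j => signedPow m (u.rep (j / n)) - signedPow m (v.rep (j / n)))‖ ≤
      (3 * B ^ (2 * m) + 36 * (Real.sqrt (1 / n)) ^ m * Real.sqrt (2 * R) *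
        (‖u‖ + ‖v‖) ^ (2 * m)) * ‖u - v‖ := by
  set τ : ℝ := Real.sqrt (1 / n) with hτ
  set S : ℝ := ‖u‖ + ‖v‖ with hS
  set w : ℝ := ‖u - v‖ with hw
  have hn' : (0 : ℝ) < n := by exact_mod_cast hn
  have hB : 0 ≤ B := (abs_nonneg _).trans (hu R (le_abs_self _))
  have hS0 : 0 ≤ S := by positivity
  have hτ0 : 0 ≤ τ := Real.sqrt_nonneg _
  have hτ1 : τ ≤ 1 := by
    rw [hτ, Real.sqrt_le_one, div_le_one hn']
    exact_mod_cast hn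
  -- Pointwise bound on `[-R, R)`, with `36 = 3 (2·2·2 + 4)`. The factor `√(2R)` in the conclusion
  -- is the `L²` norm of the indicator of this interval.
  set c₂ : ℝ := 36 * τ ^ m * S ^ (2 * m) * w with hc₂
  have hc₂0 : 0 ≤ c₂ := by positivity
  have hfin : volume (Ico (-R : ℝ) R) ≠ ∞ := by simp
  set D : H := indicatorConstLp 2 measurableSet_Ico hfin c₂ with hD
  have hDn : ‖D‖ = c₂ * Real.sqrt (2 * R) := by
    rw [hD, norm_indicatorConstLp (by norm_num) (by norm_num), Real.norm_of_nonneg hc₂0]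
    simp [Real.sqrt_eq_rpow, measureReal_def, Real.volume_Ico]
    left
    rw [two_mul]
  set F : H := (3 * B ^ (2 * m)) • |(u - v).toL2| + D with hF
  have hFn : ‖F‖ ≤ 3 * B ^ (2 * m) * w + c₂ * Real.sqrt (2 * R) := by
    rw [← hDn]
    refine (norm_add_le _ _).trans (add_le_add ?_ le_rfl)
    rw [norm_smul, Real.norm_of_nonneg (by positivity), norm_abs_eq_norm]
    exact mul_le_mul_of_nonneg_left (u - v).norm_toL2_le (by positivity)
  refine (Lp.norm_le_norm_of_ae_le (g := F) ?_).trans (hFn.trans (le_of_eq (by rw [hc₂]; ring)))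
  filter_upwards [nonlin_sub_ae_eq hm0 u v, stepFun_ae_eq (R := R) hn
      (fun j => signedPow m (u.rep (j / n)) - signedPow m (v.rep (j / n))),
    Lp.coeFn_sub (nonlin m u - nonlin m v) (stepFun R n
      (fun j => signedPow m (u.rep (j / n)) - signedPow m (v.rep (j / n)))),
    Lp.coeFn_add ((3 * B ^ (2 * m)) • |(u - v).toL2|) D,
    Lp.coeFn_smul (3 * B ^ (2 * m)) |(u - v).toL2|, Lp.coeFn_abs (u - v).toL2,
    (u - v).toL2_ae_eq_rep,
    indicatorConstLp_coeFn (p := 2) (hs := measurableSet_Ico) (hμs := hfin) (c := c₂)]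
    with x h1 h2 h3 h4 h5 h6 h7 h8
  rw [h3, h4, Pi.sub_apply, Pi.add_apply, h1, h2, h5, Pi.smul_apply, h6, h7, h8, H1.rep_sub,
    Real.norm_eq_abs, smul_eq_mul]
  refine le_trans ?_ (le_abs_self _)
  by_cases hx : x ∈ Ico (-R : ℝ) R
  · rw [indicator_of_mem hx, indicator_of_mem hx]
    refine le_trans ?_ (le_add_of_nonneg_left (by positivity))
    set y : ℝ := (⌊x * n⌋ : ℝ) / n with hy
    have hxy : |x - y| ≤ 1 / n := by
      have e : x - y = (x * n - ⌊x * n⌋) / n := by rw [hy]; field_simp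
      rw [e, abs_div, abs_of_pos hn', abs_of_nonneg (sub_nonneg.2 (Int.floor_le _))]
      gcongr
      linarith [Int.lt_floor_add_one (x * n)]
    have hsq : Real.sqrt |x - y| ≤ τ := Real.sqrt_le_sqrt hxy
    have bd : ∀ (z : H1), ‖z‖ ≤ S → ∀ x, |z.rep x| ≤ 2 * S := fun z hz x =>
      (z.abs_rep_le x).trans (by linarith)
    have hol : ∀ z : H1, |z.rep x - z.rep y| ≤ τ * ‖z‖ := fun z =>
      (z.abs_rep_sub_le x y).trans (mul_le_mul_of_nonneg_right hsq (norm_nonneg _))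
    have huS : ‖u‖ ≤ S := by rw [hS]; linarith [norm_nonneg v]
    have hvS : ‖v‖ ≤ S := by rw [hS]; linarith [norm_nonneg u]
    have k1 := abs_signedPow_sub_sub_le hm0 hm1.le (bd u huS x) (bd v hvS x) (bd u huS y)
      (bd v hvS y) ((hol u).trans (mul_le_mul_of_nonneg_left huS hτ0))
      ((hol v).trans (mul_le_mul_of_nonneg_left hvS hτ0))
    have k2 : |u.rep x - v.rep x| ≤ 2 * w := by
      rw [← H1.rep_sub]; exact (u - v).abs_rep_le x
    have k3 : |u.rep x - v.rep x - (u.rep y - v.rep y)| ≤ τ * w := by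
      rw [← H1.rep_sub, ← H1.rep_sub]; exact hol (u - v)
    refine k1.trans ?_
    have e1 : (2 * S) ^ m * (τ * S) ^ m = 2 ^ m * τ ^ m * S ^ (2 * m) := by
      rw [Real.mul_rpow (by norm_num) hS0, Real.mul_rpow hτ0 hS0, two_mul m,
        Real.rpow_add_of_nonneg hS0 hm0.le hm0.le]
      ring
    have e2 : (2 * S) ^ (2 * m) = 2 ^ (2 * m) * S ^ (2 * m) := by
      rw [Real.mul_rpow (by norm_num) hS0]
    have p1 : (2 : ℝ) ^ m ≤ 2 := by
      simpa using Real.rpow_le_rpow_of_exponent_le (by norm_num : (1 : ℝ) ≤ 2) hm1.le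
    have p2 : (2 : ℝ) ^ (2 * m) ≤ 4 := by
      have := Real.rpow_le_rpow_of_exponent_le (by norm_num : (1 : ℝ) ≤ 2)
        (by linarith : 2 * m ≤ 2)
      rw [Real.rpow_two] at this
      linarith
    -- As `τ ≤ 1`, the Lipschitz contribution `τ` is absorbed into the Hölder contribution `τ^m`.
    have p3 : τ ≤ τ ^ m := by
      rcases hτ0.eq_or_lt with h | h
      · rw [← h, Real.zero_rpow hm0.ne']
      · simpa using Real.rpow_le_rpow_of_exponent_ge h hτ1 hm1.le
    have q0 : 0 ≤ S ^ (2 * m) := by positivity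
    have q1 : 0 ≤ τ ^ m := by positivity
    have w0 : 0 ≤ w := norm_nonneg _
    calc (2 * m + 1) * (2 * (2 * S) ^ m * (τ * S) ^ m * |u.rep x - v.rep x|
          + (2 * S) ^ (2 * m) * |u.rep x - v.rep x - (u.rep y - v.rep y)|)
        ≤ (2 * m + 1) * (2 * (2 * S) ^ m * (τ * S) ^ m * (2 * w) + (2 * S) ^ (2 * m) * (τ * w)) := by
          gcongr
      _ = (2 * m + 1) * (2 * (2 ^ m * τ ^ m * S ^ (2 * m)) * (2 * w)
            + 2 ^ (2 * m) * S ^ (2 * m) * (τ * w)) := by rw [← e1, ← e2]; ring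
      _ ≤ 3 * (2 * (2 * τ ^ m * S ^ (2 * m)) * (2 * w) + 4 * S ^ (2 * m) * (τ ^ m * w)) := by
          gcongr
          linarith
      _ = c₂ := by rw [hc₂]; ring
  · rw [indicator_of_notMem hx, indicator_of_notMem hx, sub_zero, add_zero]
    have hx' : (R : ℝ) ≤ |x| := by
      by_contra hcon
      rw [not_le, abs_lt] at hcon
      exact hx ⟨hcon.1.le, hcon.2⟩
    refine (abs_signedPow_sub_le hm0 (hu x hx') (hv x hx')).trans ?_
    gcongr
    linarith

/-- The Foiaş-Prodi type estimate: up to the tails, high modes of the nonlinear difference are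
small. -/
lemma exists_norm_tailProj_nonlin_sub_le {m : ℝ} (hm0 : 0 < m) (hm1 : m < 1)
    (e : HilbertBasis ℕ ℝ H) (R : ℕ) {κ : ℝ} (hκ : 0 < κ) :
    ∃ N : ℕ, 1 ≤ N ∧ ∀ (u v : H1) (B : ℝ), (∀ x : ℝ, R ≤ |x| → |u.rep x| ≤ B) →
      (∀ x : ℝ, R ≤ |x| → |v.rep x| ≤ B) →
      ‖tailProj e N (nonlin m u - nonlin m v)‖ ≤
        (3 * B ^ (2 * m) + κ * (‖u‖ + ‖v‖) ^ (2 * m)) * ‖u - v‖ := by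
  obtain ⟨n, hn, hnκ⟩ : ∃ n : ℕ, 0 < n ∧
      36 * (Real.sqrt (1 / n)) ^ m * Real.sqrt (2 * R) ≤ κ / 2 := by
    have h1 : Tendsto (fun n : ℕ => 36 * (Real.sqrt (1 / n)) ^ m * Real.sqrt (2 * R)) atTop
        (𝓝 (36 * (Real.sqrt 0) ^ m * Real.sqrt (2 * R))) := by
      refine ((Tendsto.rpow_const ?_ (Or.inr hm0.le)).const_mul _).mul_const _
      exact (Real.continuous_sqrt.tendsto 0).comp tendsto_one_div_atTop_nhds_zero_nat
    rw [Real.sqrt_zero, Real.zero_rpow hm0.ne', mul_zero, zero_mul] at h1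
    obtain ⟨n, h2, h3⟩ := ((h1.eventually_le_const (half_pos hκ)).and (eventually_gt_atTop 0)).exists
    exact ⟨n, h3, h2⟩
  -- With `R` and `n` fixed, the approximants span a finite-dimensional space, so strong convergence
  -- of `P_N` gives one `N` valid for all `u` and `v`. The factor 24 = 3·4·2 comes from the
  -- coefficient bound `hcj`.
  obtain ⟨N, hN, hNκ⟩ : ∃ N : ℕ, 1 ≤ N ∧
      24 * ∑ j ∈ Finset.Ico (-(R * n : ℤ)) (R * n), ‖tailProj e N (meshIndicator n j)‖ ≤ κ / 2 := by
    have h1 : Tendsto (fun N => 24 * ∑ j ∈ Finset.Ico (-(R * n : ℤ)) (R * n),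
        ‖tailProj e N (meshIndicator n j)‖) atTop
        (𝓝 (24 * ∑ j ∈ Finset.Ico (-(R * n : ℤ)) (R * n), (0 : ℝ))) :=
      (tendsto_finsetSum _ fun j _ => tendsto_tailProj e _).const_mul _
    rw [Finset.sum_const_zero, mul_zero] at h1
    obtain ⟨N, h2, h3⟩ := ((h1.eventually_le_const (half_pos hκ)).and (eventually_ge_atTop 1)).exists
    exact ⟨N, h3, h2⟩
  refine ⟨N, hN, fun u v B hu hv => ?_⟩
  set S : ℝ := ‖u‖ + ‖v‖ with hS
  set w : ℝ := ‖u - v‖ with hw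
  have hS0 : 0 ≤ S := by positivity
  set c : ℤ → ℝ := fun j => signedPow m (u.rep (j / n)) - signedPow m (v.rep (j / n)) with hc
  have hcj : ∀ j, |c j| ≤ 24 * S ^ (2 * m) * w := fun j => by
    have h1 : |c j| ≤ (2 * m + 1) * (2 * S) ^ (2 * m) * |u.rep (j / n) - v.rep (j / n)| :=
      abs_signedPow_sub_le hm0 ((u.abs_rep_le _).trans (by linarith [norm_nonneg v]))
        ((v.abs_rep_le _).trans (by linarith [norm_nonneg u]))
    have k2 : |u.rep (j / n) - v.rep (j / n)| ≤ 2 * w := by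
      rw [← H1.rep_sub]; exact (u - v).abs_rep_le _
    have p2 : (2 : ℝ) ^ (2 * m) ≤ 4 := by
      have := Real.rpow_le_rpow_of_exponent_le (by norm_num : (1 : ℝ) ≤ 2)
        (by linarith : 2 * m ≤ 2)
      rw [Real.rpow_two] at this
      linarith
    rw [Real.mul_rpow (by norm_num) hS0] at h1
    calc |c j| ≤ _ := h1
      _ ≤ 3 * (4 * S ^ (2 * m)) * (2 * w) := by
        gcongr
        linarith
      _ = _ := by ring
  have h1 := norm_nonlin_sub_sub_stepFun_le hm0 hm1 hn u v hu hv
  have h2 : ‖tailProj e N (stepFun R n c)‖ ≤ κ / 2 * S ^ (2 * m) * w := by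
    rw [stepFun, map_sum]
    calc _ ≤ ∑ j ∈ Finset.Ico (-(R * n : ℤ)) (R * n),
          24 * S ^ (2 * m) * w * ‖tailProj e N (meshIndicator n j)‖ := by
          refine norm_sum_le_of_le _ fun j _ => ?_
          rw [map_smul, norm_smul]
          exact mul_le_mul_of_nonneg_right (hcj j) (norm_nonneg _)
      _ = (24 * ∑ j ∈ Finset.Ico (-(R * n : ℤ)) (R * n), ‖tailProj e N (meshIndicator n j)‖) *
            (S ^ (2 * m) * w) := by rw [← Finset.mul_sum]; ring
      _ ≤ κ / 2 * (S ^ (2 * m) * w) := mul_le_mul_of_nonneg_right hNκ (by positivity)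
      _ = _ := by ring
  have h3 : tailProj e N (nonlin m u - nonlin m v) =
      tailProj e N (nonlin m u - nonlin m v - stepFun R n c) + tailProj e N (stepFun R n c) := by
    rw [← map_add, sub_add_cancel]
  rw [h3]
  refine (norm_add_le _ _).trans ((add_le_add ((norm_tailProj_apply_le e N _).trans h1) h2).trans ?_)
  have h4 : 36 * (Real.sqrt (1 / n)) ^ m * Real.sqrt (2 * R) * S ^ (2 * m) * w ≤
      κ / 2 * S ^ (2 * m) * w := by gcongr
  nlinarith [h4]

/-! ### The weight -/

lemma logWeight_pos (x : ℝ) : 0 < logWeight x := Real.log_pos (by nlinarith [sq_nonneg x])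

/-- From `e^{-a} ≤ 1/(1+a)` one gets `ψ ≥ tφ/(t+φ)`, and the denominator is at most twice the larger
of `t` and `φ`. -/
lemma half_min_le_psi {t x : ℝ} (ht : 0 < t) : min t (logWeight x) / 2 ≤ psi t x := by
  have hφ := logWeight_pos x
  rw [psi]
  set φ := logWeight x
  have h1 : Real.exp (-t / φ) ≤ φ / (φ + t) := by
    rw [neg_div, Real.exp_neg, inv_le_comm₀ (Real.exp_pos _) (by positivity), inv_div]
    have := Real.add_one_le_exp (t / φ)
    calc (φ + t) / φ = t / φ + 1 := by field_simp; ring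
      _ ≤ _ := this
  have h2 : t * φ / (φ + t) ≤ φ * (1 - Real.exp (-t / φ)) := by
    calc t * φ / (φ + t) = φ * (1 - φ / (φ + t)) := by field_simp; ring
      _ ≤ _ := by gcongr
  refine le_trans ?_ h2
  rw [div_le_div_iff₀ (by norm_num) (by positivity)]
  rcases le_total t φ with h | h
  · rw [min_eq_left h]; nlinarith
  · rw [min_eq_right h]; nlinarith

lemma logWeight_le {R x : ℝ} (hR : 0 ≤ R) (hx : R ≤ |x|) : logWeight R ≤ logWeight x := by
  refine Real.log_le_log (by positivity) ?_
  have := mul_self_le_mul_self hR hx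
  rw [abs_mul_abs_self] at this
  nlinarith

lemma tendsto_logWeight_natCast : Tendsto (fun R : ℕ => logWeight R) atTop atTop := by
  refine Real.tendsto_log_atTop.comp (tendsto_atTop_add_const_right _ _ ?_)
  exact (tendsto_pow_atTop two_ne_zero).comp tendsto_natCast_atTop_atTop

/-- The pointwise bound on the weighted function by the weighted norm. -/
lemma ofReal_sq_psi_mul_rep_le (r : ℝ) (u : H1) (x : ℝ) :
    ENNReal.ofReal ((psi r x * u.rep x) ^ 2) ≤ 4 * weightedNormSq r u := by
  rw [weightedNormSq, eNormSqH1, ENNReal.mul_iInf_of_ne (by norm_num) (by norm_num)]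
  -- Any `p` in `H¹` representing `ψ u` has `p.rep = ψ u.rep` everywhere by continuity. The bound
  -- `|p.rep| ≤ 2‖p‖` then gives the factor 4; without such a `p` the infimum is infinite.
  refine le_iInf fun p => ?_
  rw [ENNReal.mul_iInf_of_ne (by norm_num) (by norm_num)]
  refine le_iInf fun hp => ?_
  have hlw : Continuous logWeight :=
    Continuous.log (by fun_prop) fun x => by positivity
  have hψ : Continuous fun x => psi r x :=
    hlw.mul (continuous_const.sub (Real.continuous_exp.comp
      (continuous_const.div hlw fun x => (logWeight_pos x).ne')))
  have : p.rep = fun x => psi r x * u.rep x := by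
    refine (p.continuous_rep.ae_eq_iff_eq volume (hψ.mul u.continuous_rep)).1 ?_
    filter_upwards [hp, p.toL2_ae_eq_rep, u.toL2_ae_eq_rep] with x h1 h2 h3
    rw [← h2, h1, h3, Pi.mul_apply]
  rw [← congrFun this x, ← ofReal_norm, ← ENNReal.ofReal_pow (norm_nonneg _),
    show (4 : ℝ≥0∞) = ENNReal.ofReal 4 by simp, ← ENNReal.ofReal_mul (by norm_num)]
  refine ENNReal.ofReal_le_ofReal ?_
  rw [← sq_abs]
  nlinarith [p.abs_rep_le x, abs_nonneg (p.rep x), norm_nonneg p]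

/-- At times beyond `φ(R)` the weight exceeds `φ(R)/2` outside `(-R, R)`. The gain `4/φ(R)` makes
the tails small as `R` grows. -/
lemma abs_rep_le_of_weightedNormSq {r R x : ℝ} (hR : 0 ≤ R) (hr : logWeight R ≤ r) (u : H1)
    (hu : weightedNormSq r u ≠ ∞) (hx : R ≤ |x|) :
    |u.rep x| ≤ 4 / logWeight R * Real.sqrt (weightedNormSq r u).toReal := by
  have hφ := logWeight_pos R
  have h1 : (psi r x * u.rep x) ^ 2 ≤ 4 * (weightedNormSq r u).toReal := by
    have := ENNReal.toReal_mono (ENNReal.mul_ne_top (by norm_num) hu)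
      (ofReal_sq_psi_mul_rep_le r u x)
    rwa [ENNReal.toReal_ofReal (sq_nonneg _), ENNReal.toReal_mul, ENNReal.toReal_ofNat] at this
  have h2 : logWeight R / 2 ≤ psi r x :=
    le_trans (by have := le_min hr (logWeight_le hR hx); linarith)
      (half_min_le_psi (hφ.trans_le hr))
  have h3 : |psi r x * u.rep x| ≤ 2 * Real.sqrt (weightedNormSq r u).toReal := by
    refine abs_le_of_sq_le_sq ?_ (by positivity)
    rw [mul_pow 2, Real.sq_sqrt ENNReal.toReal_nonneg]
    linarith
  rw [abs_mul, abs_of_nonneg (by linarith)] at h3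
  have h4 : logWeight R / 2 * |u.rep x| ≤ psi r x * |u.rep x| :=
    mul_le_mul_of_nonneg_right h2 (abs_nonneg _)
  rw [div_mul_eq_mul_div, le_div_iff₀ hφ]
  linarith

/-- The high modes of the nonlinear difference are small with respect to the weighted norms. -/
lemma exists_norm_tailProj_nonlin_sub_le_weighted {m : ℝ} (hm0 : 0 < m) (hm1 : m < 1)
    (e : HilbertBasis ℕ ℝ H) {δ : ℝ} (hδ : 0 < δ) :
    ∃ T₀ : ℝ, 0 < T₀ ∧ ∃ N : ℕ, 1 ≤ N ∧ ∀ (r : ℝ) (u v : H1), T₀ ≤ r →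
      weightedNormSq r u ≠ ∞ → weightedNormSq r v ≠ ∞ →
      ‖tailProj e N (nonlin m u - nonlin m v)‖ ≤
        δ * (1 + (‖u‖ ^ 2 + ‖v‖ ^ 2 + (weightedNormSq r u).toReal
          + (weightedNormSq r v).toReal)) * ‖u - v‖ := by
  obtain ⟨R, hR⟩ : ∃ R : ℕ, 3 * (4 / logWeight R) ^ (2 * m) ≤ δ / 2 := by
    have h1 : Tendsto (fun R : ℕ => 3 * (4 / logWeight R) ^ (2 * m)) atTop
        (𝓝 (3 * 0 ^ (2 * m))) :=
      ((tendsto_logWeight_natCast.const_div_atTop 4).rpow_const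
        (Or.inr (by positivity))).const_mul _
    rw [Real.zero_rpow (by positivity), mul_zero] at h1
    exact (h1.eventually_le_const (half_pos hδ)).exists
  obtain ⟨N, hN, h⟩ := exists_norm_tailProj_nonlin_sub_le hm0 hm1 e R (κ := δ / 4) (by positivity)
  -- The waiting time is `φ(R)`. The choice `κ = δ/4` leaves room for the factor 2 in `(a + b)² ≤
  -- 2(a² + b²)`.
  refine ⟨logWeight R, logWeight_pos R, N, hN, fun r u v hr hu hv => ?_⟩
  set a := (weightedNormSq r u).toReal with ha
  set b := (weightedNormSq r v).toReal with hb
  have ha0 : 0 ≤ a := ENNReal.toReal_nonneg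
  have hb0 : 0 ≤ b := ENNReal.toReal_nonneg
  have hφ := logWeight_pos R
  have hB := h u v (4 / logWeight R * Real.sqrt (a + b))
    (fun x hx => (abs_rep_le_of_weightedNormSq (by positivity) hr u hu hx).trans (by
      gcongr; linarith))
    (fun x hx => (abs_rep_le_of_weightedNormSq (by positivity) hr v hv hx).trans (by
      gcongr; linarith))
  refine hB.trans (mul_le_mul_of_nonneg_right ?_ (norm_nonneg _))
  rw [Real.mul_rpow (by positivity) (by positivity)]
  have h1 := rpow_two_mul_le_one_add_sq hm0 hm1.le (Real.sqrt_nonneg (a + b))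
  rw [Real.sq_sqrt (by positivity)] at h1
  have h2 := rpow_two_mul_le_one_add_sq hm0 hm1.le (by positivity : 0 ≤ ‖u‖ + ‖v‖)
  have h3 : 3 * (4 / logWeight R) ^ (2 * m) * Real.sqrt (a + b) ^ (2 * m) ≤
      δ / 2 * (1 + (a + b)) := mul_le_mul hR h1 (by positivity) (by positivity)
  have h4 : δ / 4 * (‖u‖ + ‖v‖) ^ (2 * m) ≤ δ / 4 * (1 + 2 * (‖u‖ ^ 2 + ‖v‖ ^ 2)) := by
    refine mul_le_mul_of_nonneg_left (h2.trans ?_) (by positivity)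
    nlinarith [sq_nonneg (‖u‖ - ‖v‖)]
  nlinarith [mul_nonneg hδ.le ha0, mul_nonneg hδ.le hb0, mul_nonneg hδ.le (sq_nonneg ‖u‖),
    mul_nonneg hδ.le (sq_nonneg ‖v‖)]

/-! ### The energy form -/

instance : SecondCountableTopologyEither ℝ Phase := secondCountableTopologyEither_of_left ℝ Phase

/-- The embedding `H¹ ⊂ L²` as a continuous linear map. -/
noncomputable def H1.toL2L : H1 →L[ℝ] H :=
  LinearMap.mkContinuous
    { toFun := H1.toL2, map_add' := H1.toL2_add, map_smul' := H1.toL2_smul } 1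
    fun u => by simpa using u.norm_toL2_le

/-- `y ↦ y₂ + α y₁`. -/
noncomputable def momentum (α : ℝ) : Phase →L[ℝ] H :=
  ContinuousLinearMap.snd ℝ H1 H + α • H1.toL2L.comp (ContinuousLinearMap.fst ℝ H1 H)

lemma momentum_apply (α : ℝ) (y : Phase) : momentum α y = y.2 + α • y.1.toL2 := rfl

/-- The bilinear form of the energy `phaseNormSq`. -/
noncomputable def energyForm (α : ℝ) (y z : Phase) : ℝ :=
  ⟪y.1, z.1⟫_ℝ + ⟪momentum α y, momentum α z⟫_ℝ

lemma energyForm_self (α : ℝ) (y : Phase) : energyForm α y y = phaseNormSq α y := by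
  rw [energyForm, real_inner_self_eq_norm_sq, real_inner_self_eq_norm_sq, momentum_apply,
    phaseNormSq]

lemma energyForm_smul_right (α c : ℝ) (y z : Phase) :
    energyForm α y (c • z) = c * energyForm α y z := by
  have h : ⟪y.1, (c • z).1⟫_ℝ = c * ⟪y.1, z.1⟫_ℝ := real_inner_smul_right y.1 z.1 c
  rw [energyForm, h, map_smul, real_inner_smul_right, energyForm]
  ring

lemma energyForm_comm (α : ℝ) (y z : Phase) : energyForm α y z = energyForm α z y := by
  rw [energyForm, energyForm, real_inner_comm, real_inner_comm (momentum α y)]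

lemma energyForm_smul_left (α c : ℝ) (y z : Phase) :
    energyForm α (c • y) z = c * energyForm α y z := by
  rw [energyForm_comm, energyForm_smul_right, energyForm_comm]

lemma energyForm_add_left (α : ℝ) (x y z : Phase) :
    energyForm α (x + y) z = energyForm α x z + energyForm α y z := by
  simp only [energyForm, map_add, Prod.fst_add, inner_add_left]
  ring

/-- The increment of the energy is linear in the second slot `z`, so difference quotients can be
taken in `z` alone even when `y` moves without being differentiable. -/
lemma phaseNormSq_add (α : ℝ) (y z : Phase) :
    phaseNormSq α (y + z) = phaseNormSq α y + energyForm α ((2 : ℝ) • y + z) z := by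
  rw [← energyForm_self, ← energyForm_self, energyForm_add_left, energyForm_add_left,
    energyForm_smul_left, energyForm_comm α y (y + z), energyForm_comm α z (y + z),
    energyForm_add_left, energyForm_add_left, energyForm_comm α z y]
  ring

lemma continuous_energyForm (α : ℝ) :
    Continuous fun p : Phase × Phase => energyForm α p.1 p.2 := by
  unfold energyForm
  fun_prop

lemma continuous_phaseNormSq (α : ℝ) : Continuous (phaseNormSq α) := by
  have : phaseNormSq α = fun y => energyForm α y y := funext fun y => (energyForm_self α y).symm
  rw [this]
  exact (continuous_energyForm α).comp (continuous_id.prodMk continuous_id)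

lemma phaseNormSq_nonneg (α : ℝ) (y : Phase) : 0 ≤ phaseNormSq α y := by
  unfold phaseNormSq; positivity

lemma phaseNormSq_zero (α : ℝ) : phaseNormSq α 0 = 0 := by
  rw [← energyForm_self]; simp [energyForm]

lemma hasDerivAt_phaseNormSq (α : ℝ) {y : ℝ → Phase} {y' : Phase} {t : ℝ}
    (h : HasDerivAt y y' t) :
    HasDerivAt (fun s => phaseNormSq α (y s)) (2 * energyForm α (y t) y') t := by
  have h1 : HasDerivAt (fun s => (y s).1) y'.1 t :=
    (ContinuousLinearMap.fst ℝ H1 H).hasFDerivAt.comp_hasDerivAt t h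
  have h2 : HasDerivAt (fun s => momentum α (y s)) (momentum α y') t :=
    (momentum α).hasFDerivAt.comp_hasDerivAt t h
  have h3 := (h1.inner ℝ h1).add (h2.inner ℝ h2)
  have e : (fun s => phaseNormSq α (y s)) =
      fun s => ⟪(y s).1, (y s).1⟫_ℝ + ⟪momentum α (y s), momentum α (y s)⟫_ℝ :=
    funext fun s => by rw [← energyForm_self, energyForm]
  rw [e]
  refine h3.congr_deriv ?_
  rw [energyForm, real_inner_comm (y t).1, real_inner_comm (momentum α (y t))]
  ring

/-- The rate of change of the energy along the linear flow. -/
noncomputable def dissipation (γ α : ℝ) (y : Phase) : ℝ :=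
  2 * (-α * ‖y.1‖ ^ 2 - (γ - α) * ‖momentum α y‖ ^ 2
    + (γ - α) * α * ⟪momentum α y, H1.toL2L y.1⟫_ℝ)

lemma continuous_dissipation (γ α : ℝ) : Continuous (dissipation γ α) := by
  unfold dissipation
  fun_prop

/-- Integration by parts cancels the unbounded terms against `⟪y₁, z₁⟫`. What remains is continuous
on the whole phase space, which permits the extension beyond the domain. -/
lemma two_mul_energyForm_of_waveOp {γ α : ℝ} {y z : Phase} (h : WaveOp γ y z) :
    2 * energyForm α y z = dissipation γ α y := by
  obtain ⟨h1, d, h2, h3⟩ := h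
  have hp : momentum α y = (z.1 + α • y.1).toL2 := by
    rw [momentum_apply, ← h1]; rfl
  have hz : momentum α z = d.dx - y.1.toL2 - (γ - α) • z.1.toL2 := by
    rw [momentum_apply, h3, ← h1, sub_smul]; abel
  have hibp := H1.inner_dx d (z.1 + α • y.1)
  rw [h2, H1.dx_add, H1.dx_smul, inner_add_right, real_inner_smul_right,
    real_inner_self_eq_norm_sq] at hibp
  have e1 : ⟪momentum α y, momentum α z⟫_ℝ = ⟪d.dx, (z.1 + α • y.1).toL2⟫_ℝ
      - ⟪y.1.toL2, (z.1 + α • y.1).toL2⟫_ℝ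
      - (γ - α) * ⟪z.1.toL2, (z.1 + α • y.1).toL2⟫_ℝ := by
    rw [hz, hp, real_inner_comm, inner_sub_left, inner_sub_left, real_inner_smul_left]
  have hL : ∀ u : H1, H1.toL2L u = u.toL2 := fun _ => rfl
  rw [dissipation, energyForm, e1, hibp, H1.inner_eq, H1.norm_sq_eq,
    ← real_inner_self_eq_norm_sq (momentum α y), hp, hL, H1.toL2_add, H1.toL2_smul,
    ← real_inner_self_eq_norm_sq y.1.toL2]
  simp only [inner_add_left, inner_add_right, real_inner_smul_left, real_inner_smul_right]
  rw [real_inner_comm y.1.toL2 z.1.toL2]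
  ring

/-! ### The wave group -/

namespace IsWaveGroup

variable {γ : ℝ} {U : ℝ → Phase →L[ℝ] Phase}

lemma apply_add (hU : IsWaveGroup γ U) (s t : ℝ) (y : Phase) : U (s + t) y = U s (U t y) := by
  rw [hU.add]; rfl

lemma apply_zero (hU : IsWaveGroup γ U) (y : Phase) : U 0 y = y := by
  rw [hU.zero]; rfl

lemma apply_neg_apply (hU : IsWaveGroup γ U) (t : ℝ) (y : Phase) : U t (U (-t) y) = y := by
  rw [← hU.apply_add, add_neg_cancel, hU.apply_zero]

lemma exists_norm_le (hU : IsWaveGroup γ U) (a b : ℝ) :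
    ∃ M : ℝ, 0 ≤ M ∧ ∀ r ∈ Icc a b, ‖U r‖ ≤ M := by
  obtain ⟨M, hM⟩ := banach_steinhaus (g := fun r : Icc a b => U r) fun y => by
    obtain ⟨C, hC⟩ := isCompact_Icc.exists_bound_of_continuousOn (hU.cont y).continuousOn
      (s := Icc a b)
    exact ⟨C, fun i => hC i i.2⟩
  exact ⟨max M 0, le_max_right _ _, fun r hr => (hM ⟨r, hr⟩).trans (le_max_left _ _)⟩

/-- Strong continuity becomes joint continuity because the group is locally bounded in operator
norm, by Banach–Steinhaus. -/
lemma tendsto_apply (hU : IsWaveGroup γ U) {ι : Type*} {l : Filter ι} {f : ι → ℝ} {y : ι → Phase}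
    {a : ℝ} {b : Phase} (hf : Tendsto f l (𝓝 a)) (hy : Tendsto y l (𝓝 b)) :
    Tendsto (fun i => U (f i) (y i)) l (𝓝 (U a b)) := by
  obtain ⟨M, hM0, hM⟩ := hU.exists_norm_le (a - 1) (a + 1)
  have h1 : Tendsto (fun i => U (f i) (y i - b)) l (𝓝 0) := by
    have h3 : Tendsto (fun i => M * ‖y i - b‖) l (𝓝 0) := by
      simpa using (tendsto_iff_norm_sub_tendsto_zero.1 hy).const_mul M
    refine squeeze_zero_norm' ?_ h3
    filter_upwards [hf (Icc_mem_nhds (sub_one_lt a) (lt_add_one a))] with i hi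
    exact (U (f i)).le_of_opNorm_le (hM _ hi) _
  have h2 : Tendsto (fun i => U (f i) b) l (𝓝 (U a b)) := ((hU.cont b).tendsto a).comp hf
  have h4 := h1.add h2
  rw [zero_add] at h4
  refine h4.congr fun i => ?_
  rw [← map_add, sub_add_cancel]

lemma continuous_apply (hU : IsWaveGroup γ U) {X : Type*} [TopologicalSpace X] {f : X → ℝ}
    {y : X → Phase} (hf : Continuous f) (hy : Continuous y) :
    Continuous fun x => U (f x) (y x) :=
  continuous_iff_continuousAt.2 fun x => hU.tendsto_apply (hf.tendsto x) (hy.tendsto x)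

lemma hasDerivAt (hU : IsWaveGroup γ U) {y z : Phase} (h : WaveOp γ y z) (t : ℝ) :
    HasDerivAt (fun s => U s y) (U t z) t := by
  have h0 : HasDerivAt (fun s => U s y) z (t - t) := by rw [sub_self]; exact (hU.generator y z).2 h
  have h1 := (U t).hasFDerivAt.comp_hasDerivAt t (h0.comp_sub_const t t)
  refine h1.congr_of_eventuallyEq (Eventually.of_forall fun s => ?_)
  simp only [Function.comp]
  rw [← hU.apply_add]; congr 2; ring

lemma waveOp_apply (hU : IsWaveGroup γ U) {y z : Phase} (h : WaveOp γ y z) (t : ℝ) :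
    WaveOp γ (U t y) (U t z) := by
  rw [← hU.generator]
  have h0 : HasDerivAt (fun s => U s y) (U t z) (0 + t) := by rw [zero_add]; exact hU.hasDerivAt h t
  refine (h0.comp_add_const 0 t).congr_of_eventuallyEq (Eventually.of_forall fun s => ?_)
  exact (hU.apply_add s t y).symm

/-- Time averages of orbits lie in the domain of the generator. -/
lemma waveOp_average (hU : IsWaveGroup γ U) (y : Phase) (h : ℝ) :
    WaveOp γ (h⁻¹ • ∫ s in (0 : ℝ)..h, U s y) (h⁻¹ • (U h y - y)) := by
  rw [← hU.generator]
  have hc := hU.cont y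
  have e : (fun t => U t (h⁻¹ • ∫ s in (0 : ℝ)..h, U s y)) =
      fun t => h⁻¹ • ((∫ s in (0 : ℝ)..(t + h), U s y) - ∫ s in (0 : ℝ)..t, U s y) := by
    funext t
    rw [map_smul, ← ContinuousLinearMap.intervalIntegral_comp_comm _ (hc.intervalIntegrable _ _)]
    simp_rw [← hU.apply_add]
    rw [intervalIntegral.integral_comp_add_left (fun s => U s y), add_zero,
      intervalIntegral.integral_interval_sub_left (hc.intervalIntegrable _ _)
        (hc.intervalIntegrable _ _)]
  rw [e]
  have d : ∀ t, HasDerivAt (fun t => ∫ s in (0 : ℝ)..t, U s y) (U t y) t := fun t =>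
    intervalIntegral.integral_hasDerivAt_right (hc.intervalIntegrable _ _)
      (hc.stronglyMeasurableAtFilter _ _) hc.continuousAt
  have d1 : HasDerivAt (fun t => ∫ s in (0 : ℝ)..(t + h), U s y) (U h y) 0 := by
    have := (d (0 + h)).comp_add_const 0 h
    rwa [zero_add] at this
  have d2 := d 0
  rw [hU.apply_zero] at d2
  exact (d1.sub d2).const_smul h⁻¹

lemma tendsto_average (hU : IsWaveGroup γ U) (y : Phase) :
    Tendsto (fun h : ℝ => h⁻¹ • ∫ s in (0 : ℝ)..h, U s y) (𝓝[≠] 0) (𝓝 y) := by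
  have hc := hU.cont y
  have d : HasDerivAt (fun t => ∫ s in (0 : ℝ)..t, U s y) (U 0 y) 0 :=
    intervalIntegral.integral_hasDerivAt_right (hc.intervalIntegrable _ _)
      (hc.stronglyMeasurableAtFilter _ _) hc.continuousAt
  rw [hU.apply_zero, hasDerivAt_iff_tendsto_slope] at d
  refine d.congr fun h => ?_
  simp [slope_def_module]

lemma integral_dissipation_of_waveOp (hU : IsWaveGroup γ U) (α : ℝ) {y z : Phase}
    (h : WaveOp γ y z) (t : ℝ) :
    phaseNormSq α (U t y) - phaseNormSq α y = ∫ r in (0 : ℝ)..t, dissipation γ α (U r y) := by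
  have := intervalIntegral.integral_eq_sub_of_hasDerivAt (a := 0) (b := t)
    (f := fun s => phaseNormSq α (U s y)) (f' := fun r => dissipation γ α (U r y))
    (fun s _ => (hasDerivAt_phaseNormSq α (hU.hasDerivAt h s)).congr_deriv
      (two_mul_energyForm_of_waveOp (hU.waveOp_apply h s)))
    (((continuous_dissipation γ α).comp (hU.cont y)).intervalIntegrable _ _)
  rw [this, hU.apply_zero]

lemma abs_dissipation_le (γ α : ℝ) (hα : 0 ≤ α) : ∃ K : ℝ, 0 ≤ K ∧
    ∀ y : Phase, |dissipation γ α y| ≤ K * ‖y‖ ^ 2 := by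
  set a := ‖momentum α‖
  set b := ‖H1.toL2L‖
  refine ⟨2 * (α + |γ - α| * a ^ 2 + |γ - α| * α * (a * b)), by positivity, fun y => ?_⟩
  have h1 : ‖y.1‖ ≤ ‖y‖ := norm_fst_le y
  have h2 : ‖momentum α y‖ ≤ a * ‖y‖ := (momentum α).le_opNorm y
  have h3 : ‖H1.toL2L y.1‖ ≤ b * ‖y‖ :=
    (H1.toL2L.le_opNorm _).trans (mul_le_mul_of_nonneg_left h1 (norm_nonneg H1.toL2L))
  have h4 : |⟪momentum α y, H1.toL2L y.1⟫_ℝ| ≤ (a * ‖y‖) * (b * ‖y‖) :=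
    (abs_real_inner_le_norm _ _).trans (mul_le_mul h2 h3 (norm_nonneg _) ((norm_nonneg _).trans h2))
  rw [dissipation, abs_mul, abs_two, mul_assoc 2 (α + _ + _)]
  refine mul_le_mul_of_nonneg_left ?_ (by norm_num)
  calc _ ≤ |(-α * ‖y.1‖ ^ 2)| + |(γ - α) * ‖momentum α y‖ ^ 2|
        + |(γ - α) * α * ⟪momentum α y, H1.toL2L y.1⟫_ℝ| :=
        (abs_add_le _ _).trans (add_le_add (abs_sub _ _) le_rfl)
    _ ≤ α * ‖y‖ ^ 2 + |γ - α| * (a * ‖y‖) ^ 2 + |γ - α| * α * ((a * ‖y‖) * (b * ‖y‖)) := by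
        rw [abs_mul, abs_mul, abs_mul, abs_mul, abs_neg, abs_of_nonneg hα,
          abs_of_nonneg (sq_nonneg ‖y.1‖), abs_of_nonneg (sq_nonneg ‖momentum α y‖)]
        gcongr
    _ = _ := by ring

/-- The energy identity for the linear flow, for arbitrary initial data. -/
lemma integral_dissipation (hU : IsWaveGroup γ U) {α : ℝ} (hα : 0 ≤ α) (y : Phase) (t : ℝ) :
    phaseNormSq α (U t y) - phaseNormSq α y = ∫ r in (0 : ℝ)..t, dissipation γ α (U r y) := by
  set A : ℝ → Phase := fun h => h⁻¹ • ∫ s in (0 : ℝ)..h, U s y with hA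
  have hAy : Tendsto A (𝓝[≠] 0) (𝓝 y) := hU.tendsto_average y
  have h1 : Tendsto (fun h => phaseNormSq α (U t (A h)) - phaseNormSq α (A h)) (𝓝[≠] 0)
      (𝓝 (phaseNormSq α (U t y) - phaseNormSq α y)) :=
    ((((continuous_phaseNormSq α).comp (U t).continuous).tendsto y).comp hAy).sub
      (((continuous_phaseNormSq α).tendsto y).comp hAy)
  obtain ⟨K, hK0, hK⟩ := abs_dissipation_le γ α hα
  obtain ⟨M, hM0, hM⟩ := hU.exists_norm_le (min 0 t) (max 0 t)
  have h2 : Tendsto (fun h => ∫ r in (0 : ℝ)..t, dissipation γ α (U r (A h))) (𝓝[≠] 0)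
      (𝓝 (∫ r in (0 : ℝ)..t, dissipation γ α (U r y))) := by
    refine intervalIntegral.tendsto_integral_filter_of_dominated_convergence
      (fun _ => K * (M * (‖y‖ + 1)) ^ 2) (Eventually.of_forall fun h =>
        ((continuous_dissipation γ α).comp (hU.cont _)).aestronglyMeasurable) ?_ (by simp)
      (ae_of_all _ fun r _ =>
        (((continuous_dissipation γ α).comp (U r).continuous).tendsto y).comp hAy)
    have hev : ∀ᶠ h in 𝓝[≠] 0, ‖A h‖ ≤ ‖y‖ + 1 := hAy.norm.eventually_le_const (by linarith)
    filter_upwards [hev] with h hh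
    refine ae_of_all _ fun r hr => (hK _).trans ?_
    have : ‖U r (A h)‖ ≤ M * (‖y‖ + 1) :=
      ((U r).le_of_opNorm_le (hM r (Ioc_subset_Icc_self hr)) _).trans
        (mul_le_mul_of_nonneg_left hh hM0)
    gcongr
  refine tendsto_nhds_unique h1 (h2.congr fun h => ?_)
  exact (hU.integral_dissipation_of_waveOp α (hU.waveOp_average y h) t).symm

/-- The orbit need not be differentiable, but its energy is: the integrated identity has a
continuous integrand. -/
lemma hasDerivAt_phaseNormSq_zero (hU : IsWaveGroup γ U) {α : ℝ} (hα : 0 ≤ α) (y : Phase) :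
    HasDerivAt (fun t => phaseNormSq α (U t y)) (dissipation γ α y) 0 := by
  have hc : Continuous fun r => dissipation γ α (U r y) :=
    (continuous_dissipation γ α).comp (hU.cont y)
  have d : HasDerivAt (fun t => ∫ r in (0 : ℝ)..t, dissipation γ α (U r y))
      (dissipation γ α (U 0 y)) 0 :=
    intervalIntegral.integral_hasDerivAt_right (hc.intervalIntegrable _ _)
      (hc.stronglyMeasurableAtFilter _ _) hc.continuousAt
  rw [hU.apply_zero] at d
  refine (d.const_add (phaseNormSq α y)).congr_of_eventuallyEq (Eventually.of_forall fun t => ?_)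
  change phaseNormSq α (U t y) = phaseNormSq α y + ∫ r in (0 : ℝ)..t, dissipation γ α (U r y)
  rw [← hU.integral_dissipation hα]
  ring

/-- The energy identity for the flow with a continuous force. -/
lemma hasDerivAt_phaseNormSq_forced (hU : IsWaveGroup γ U) {α : ℝ} (hα : 0 ≤ α)
    {x : ℝ → Phase} {k : Phase} {t : ℝ} (hx : HasDerivAt x (U (-t) k) t) :
    HasDerivAt (fun s => phaseNormSq α (U s (x s)))
      (dissipation γ α (U t (x t)) + 2 * energyForm α (U t (x t)) k) t := by
  set w := U t (x t) with hw
  -- Splits `U s (x s)` into the free evolution of `w` and `U s (x s - x t)`. The first has a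
  -- differentiable energy, and the difference quotients of the second converge to `k`.
  have e : (fun s => phaseNormSq α (U s (x s))) = fun s => phaseNormSq α (U (s - t) w)
      + energyForm α ((2 : ℝ) • U (s - t) w + U s (x s - x t)) (U s (x s - x t)) := by
    funext s
    rw [← phaseNormSq_add, hw, ← hU.apply_add, sub_add_cancel, ← map_add, add_sub_cancel]
  rw [e]
  refine HasDerivAt.add ?_ ?_
  · have h0 : HasDerivAt (fun s => phaseNormSq α (U s w)) (dissipation γ α w) (t - t) := by
      rw [sub_self]; exact hU.hasDerivAt_phaseNormSq_zero hα w
    exact h0.comp_sub_const t t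
  · rw [hasDerivAt_iff_tendsto_slope] at hx ⊢
    have hs : Tendsto (fun s : ℝ => s) (𝓝[≠] t) (𝓝 t) := tendsto_nhdsWithin_of_tendsto_nhds tendsto_id
    have l1 : Tendsto (fun s => U s (slope x t s)) (𝓝[≠] t) (𝓝 (U t (U (-t) k))) :=
      hU.tendsto_apply hs hx
    rw [hU.apply_neg_apply] at l1
    have hxt : Tendsto (fun s => x s - x t) (𝓝[≠] t) (𝓝 0) := by
      have h1 : Tendsto (fun s => (s - t) • slope x t s) (𝓝[≠] t) (𝓝 ((t - t) • U (-t) k)) :=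
        (hs.sub_const t).smul hx
      rw [sub_self, zero_smul] at h1
      exact h1.congr fun s => sub_smul_slope x t s
    have l2 : Tendsto (fun s => U s (x s - x t)) (𝓝[≠] t) (𝓝 (U t 0)) := hU.tendsto_apply hs hxt
    have l3 : Tendsto (fun s => U (s - t) w) (𝓝[≠] t) (𝓝 (U (t - t) w)) :=
      hU.tendsto_apply (hs.sub_const t) tendsto_const_nhds
    rw [map_zero] at l2
    rw [sub_self, hU.apply_zero] at l3
    have l4 := ((continuous_energyForm α).tendsto ((2 : ℝ) • w + 0, k)).comp
      (((l3.const_smul (2 : ℝ)).add l2).prodMk_nhds l1)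
    have e2 : energyForm α ((2 : ℝ) • w + 0) k = 2 * energyForm α w k := by
      rw [add_zero, energyForm_smul_left]
    simp only [e2] at l4
    refine l4.congr fun s => ?_
    simp only [Function.comp, slope_def_field, sub_self, map_zero]
    have e3 : ∀ y, energyForm α y 0 = 0 := fun y => by simp [energyForm]
    rw [e3, sub_zero, slope_def_module, map_smul, energyForm_smul_right, div_eq_inv_mul]

end IsWaveGroup

/-! ### Differential inequalities -/

/-- Grönwall's inequality with a time dependent rate. -/
lemma le_mul_exp_of_hasDerivAt_le {Φ D b : ℝ → ℝ} {α C : ℝ} (hΦ : ∀ t, HasDerivAt Φ (D t) t)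
    (hb : ContinuousOn b (Ici 0)) (hD : ∀ t, 0 ≤ t → D t ≤ (-α + C * b t) * Φ t) {s t : ℝ}
    (hs : 0 ≤ s) (hst : s ≤ t) :
    Φ t ≤ Φ s * Real.exp (-α * (t - s) + C * ∫ r in s..t, b r) := by
  set b' : ℝ → ℝ := fun r => b (max r 0) with hb'
  have hb'c : Continuous b' :=
    hb.comp_continuous (continuous_id.max continuous_const) fun r => mem_Ici.2 (le_max_right _ _)
  set B : ℝ → ℝ := fun t => ∫ r in (0 : ℝ)..t, b' r with hB
  have hBd : ∀ t, HasDerivAt B (b' t) t := fun t =>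
    intervalIntegral.integral_hasDerivAt_right (hb'c.intervalIntegrable _ _)
      (hb'c.stronglyMeasurableAtFilter _ _) hb'c.continuousAt
  set Ψ : ℝ → ℝ := fun t => Φ t * Real.exp (α * t - C * B t) with hΨ
  have hΨd : ∀ t, HasDerivAt Ψ
      ((D t - (-α + C * b' t) * Φ t) * Real.exp (α * t - C * B t)) t := fun t => by
    have h := (hΦ t).mul ((((hasDerivAt_id t).const_mul α).sub ((hBd t).const_mul C)).exp)
    exact h.congr_deriv (by simp only [id, Pi.sub_apply]; ring)
  have hanti : AntitoneOn Ψ (Ici 0) := by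
    refine antitoneOn_of_deriv_nonpos (convex_Ici 0)
      (fun t _ => (hΨd t).continuousAt.continuousWithinAt)
      (fun t _ => (hΨd t).differentiableAt.differentiableWithinAt) fun t ht => ?_
    rw [interior_Ici] at ht
    rw [(hΨd t).deriv]
    refine mul_nonpos_of_nonpos_of_nonneg ?_ (Real.exp_nonneg _)
    have := hD t (le_of_lt ht)
    simp only [hb', max_eq_left (le_of_lt (mem_Ioi.1 ht))]
    linarith
  have h := hanti (mem_Ici.2 hs) (mem_Ici.2 (hs.trans hst)) hst
  have hint : ∫ r in s..t, b r = B t - B s := by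
    rw [hB, intervalIntegral.integral_interval_sub_left (hb'c.intervalIntegrable _ _)
      (hb'c.intervalIntegrable _ _)]
    refine intervalIntegral.integral_congr fun r hr => ?_
    rw [uIcc_of_le hst] at hr
    simp only [hb', max_eq_left (hs.trans hr.1)]
  calc Φ t = Ψ t * Real.exp (-(α * t - C * B t)) := by
        rw [hΨ, mul_assoc, ← Real.exp_add, add_neg_cancel, Real.exp_zero, mul_one]
    _ ≤ Ψ s * Real.exp (-(α * t - C * B t)) := by gcongr
    _ = _ := by
        rw [hΨ, mul_assoc, ← Real.exp_add, hint]
        ring_nf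

lemma ofReal_integral_le_lintegral_ofReal {X : Type*} [MeasurableSpace X] {μ : Measure X}
    {g : X → ℝ} (hg : Integrable g μ) :
    ENNReal.ofReal (∫ x, g x ∂μ) ≤ ∫⁻ x, ENNReal.ofReal (g x) ∂μ := by
  have h1 : ∫ x, g x ∂μ ≤ ∫ x, max (g x) 0 ∂μ :=
    integral_mono hg hg.pos_part fun x => le_max_left _ _
  refine (ENNReal.ofReal_le_ofReal h1).trans (le_of_eq ?_)
  rw [ofReal_integral_eq_lintegral_ofReal hg.pos_part (ae_of_all _ fun x => le_max_right _ _)]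
  exact lintegral_congr fun x => by simp

/-- Grönwall's inequality for a positive function, with a rate given by a possibly infinite,
possibly non-measurable function. -/
lemma ofReal_le_mul_exp_lintegral {Φ D : ℝ → ℝ} {α : ℝ} {c : ℝ≥0∞} (hc : c ≠ ∞) {q : ℝ → ℝ≥0∞}
    (hΦ : ∀ t, HasDerivAt Φ (D t) t) (hDc : Continuous D) {s t : ℝ} (hst : s ≤ t)
    (hpos : ∀ r ∈ Icc s t, 0 < Φ r)
    (hq : ∀ r ∈ Icc s t, ENNReal.ofReal (D r / Φ r + α) ≤ c * q r) :
    ENNReal.ofReal (Φ t) ≤ ENNReal.ofReal (Φ s) *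
      EReal.exp (((-α * (t - s) : ℝ) : EReal) + ((c * ∫⁻ r in Icc s t, q r : ℝ≥0∞) : EReal)) := by
  have hs0 : 0 < Φ s := hpos s ⟨le_rfl, hst⟩
  have ht0 : 0 < Φ t := hpos t ⟨hst, le_rfl⟩
  have hgc : ContinuousOn (fun r => D r / Φ r + α) (Icc s t) :=
    (hDc.continuousOn.div (fun r _ => (hΦ r).continuousAt.continuousWithinAt)
      fun r hr => (hpos r hr).ne').add continuousOn_const
  -- The integrand is the derivative of `log Φ + α r`. Monotonicity of the lower integral and
  -- finiteness of `c` suffice, so `q` may fail to be measurable.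
  have hI : ENNReal.ofReal (∫ r in Icc s t, (D r / Φ r + α)) ≤ c * ∫⁻ r in Icc s t, q r := by
    refine (ofReal_integral_le_lintegral_ofReal hgc.integrableOn_Icc).trans ?_
    rw [← lintegral_const_mul' _ _ hc]
    exact setLIntegral_mono' measurableSet_Icc hq
  have hlog : ∫ r in Icc s t, (D r / Φ r + α) = Real.log (Φ t) - Real.log (Φ s) + α * (t - s) := by
    rw [integral_Icc_eq_integral_Ioc, ← intervalIntegral.integral_of_le hst]
    rw [← uIcc_of_le hst] at hgc hpos
    have := intervalIntegral.integral_eq_sub_of_hasDerivAt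
      (f := fun r => Real.log (Φ r) + α * r) (f' := fun r => D r / Φ r + α)
      (fun r hr => ((hΦ r).log (hpos r hr).ne').add
        (((hasDerivAt_id r).const_mul α).congr_deriv (mul_one α)))
      hgc.intervalIntegrable
    rw [this]
    ring
  set I : ℝ≥0∞ := c * ∫⁻ r in Icc s t, q r with hIdef
  by_cases hIt : I = ∞
  · rw [hIt, EReal.coe_ennreal_top, EReal.coe_add_top, EReal.exp_top,
      ENNReal.mul_top (by simpa using hs0)]
    exact le_top
  · rw [hlog] at hI
    have hJ := (ENNReal.ofReal_le_iff_le_toReal hIt).1 hI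
    have hcoe : (I : EReal) = ((I.toReal : ℝ) : EReal) :=
      (EReal.coe_ennreal_toReal hIt).symm
    rw [hcoe, ← EReal.coe_add, EReal.exp_coe, ← ENNReal.ofReal_mul hs0.le]
    refine ENNReal.ofReal_le_ofReal ?_
    rw [← Real.log_le_log_iff ht0 (by positivity), Real.log_mul hs0.ne' (Real.exp_ne_zero _),
      Real.log_exp]
    linarith

/-! ### The energy of the difference of two solutions -/

/-- The rate of decay of the energy. -/
noncomputable def decayRate (γ : ℝ) : ℝ := min (γ / 4) (1 / (2 * γ))

lemma decayRate_pos {γ : ℝ} (hγ : 0 < γ) : 0 < decayRate γ := by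
  unfold decayRate; positivity

/-- The cross term is split by Young's inequality: `X²` loses `α/2` of its `2α`, and `α γ ≤ 1/2`
bounds the cost in `Y²` by `γ`. Then `α ≤ γ/4` leaves enough damping. The rate exceeds `α` by `α/2`,
a reserve for the nonlinear force. -/
lemma dissipation_le {γ : ℝ} (hγ : 0 < γ) (y : Phase) :
    dissipation γ (decayRate γ) y ≤ -(3 / 2) * decayRate γ * phaseNormSq (decayRate γ) y := by
  have hα := decayRate_pos hγ
  have h1 : decayRate γ ≤ γ / 4 := min_le_left _ _
  have h2 : decayRate γ * γ ≤ 1 / 2 := by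
    have : decayRate γ ≤ 1 / (2 * γ) := min_le_right _ _
    rw [le_div_iff₀ (by positivity)] at this
    linarith
  set α := decayRate γ
  set X := ‖y.1‖
  set Y := ‖momentum α y‖
  have hX : 0 ≤ X := norm_nonneg _
  have hY : 0 ≤ Y := norm_nonneg _
  have h3 : ⟪momentum α y, H1.toL2L y.1⟫_ℝ ≤ Y * X :=
    (real_inner_le_norm _ _).trans (mul_le_mul_of_nonneg_left y.1.norm_toL2_le hY)
  have h4 : (γ - α) * α * ⟪momentum α y, H1.toL2L y.1⟫_ℝ ≤ γ * α * (Y * X) :=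
    (mul_le_mul_of_nonneg_left h3 (mul_nonneg (by linarith) hα.le)).trans
      (by gcongr; linarith)
  have hE : phaseNormSq α y = X ^ 2 + Y ^ 2 := by rw [phaseNormSq, ← momentum_apply]
  rw [hE, dissipation]
  have h5 : 2 * (γ * α * (Y * X)) ≤ α / 2 * X ^ 2 + 2 * γ * (α * γ) * Y ^ 2 := by
    nlinarith [mul_nonneg hα.le (sq_nonneg (X - 2 * γ * Y))]
  have h6 : 2 * γ * (α * γ) * Y ^ 2 ≤ γ * Y ^ 2 := by
    have : 2 * γ * (α * γ) ≤ γ := by nlinarith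
    gcongr
  have h7 : α * Y ^ 2 ≤ γ / 4 * Y ^ 2 := by gcongr
  nlinarith [mul_nonneg hγ.le (sq_nonneg Y)]

/-- The Duhamel integral in terms of the pulled back force. -/
lemma IsWaveGroup.duhamel_eq {γ : ℝ} {U : ℝ → Phase →L[ℝ] Phase} (hU : IsWaveGroup γ U)
    {G : ℝ → H} (hG : ContinuousOn G (Ici 0)) {t : ℝ} (ht : 0 ≤ t) :
    ∫ s in (0 : ℝ)..t, U (t - s) ((0 : H1), G s) =
      U t (∫ s in (0 : ℝ)..t, U (-s) ((0 : H1), G (max s 0))) := by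
  have hUk : Continuous fun r => U (-r) ((0 : H1), G (max r 0)) :=
    hU.continuous_apply continuous_neg (continuous_const.prodMk
      (hG.comp_continuous (continuous_id.max continuous_const)
        fun r => mem_Ici.2 (le_max_right _ _)))
  rw [← ContinuousLinearMap.intervalIntegral_comp_comm _ (hUk.intervalIntegrable _ _)]
  refine intervalIntegral.integral_congr fun r hr => ?_
  rw [uIcc_of_le ht] at hr
  simp only [max_eq_left hr.1]
  rw [← hU.apply_add, sub_eq_add_neg]

/-- The Duhamel integral is continuous in time. -/
lemma IsWaveGroup.continuousOn_duhamel {γ : ℝ} {U : ℝ → Phase →L[ℝ] Phase}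
    (hU : IsWaveGroup γ U) {G : ℝ → H} (hG : ContinuousOn G (Ici 0)) :
    ContinuousOn (fun t => ∫ s in (0 : ℝ)..t, U (t - s) ((0 : H1), G s)) (Ici 0) := by
  have hUk : Continuous fun r => U (-r) ((0 : H1), G (max r 0)) :=
    hU.continuous_apply continuous_neg (continuous_const.prodMk
      (hG.comp_continuous (continuous_id.max continuous_const)
        fun r => mem_Ici.2 (le_max_right _ _)))
  refine ContinuousOn.congr (Continuous.continuousOn ?_) fun t ht => hU.duhamel_eq hG ht
  exact hU.continuous_apply continuous_id
    (intervalIntegral.continuous_primitive (fun a b => hUk.intervalIntegrable a b) 0)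

/-- A mild solution of the forced linear equation extends to a path on the line whose energy is
continuously differentiable. -/
lemma IsWaveGroup.exists_energy_extension {γ : ℝ} {U : ℝ → Phase →L[ℝ] Phase}
    (hU : IsWaveGroup γ U) {α : ℝ} (hα : 0 ≤ α) {w : ℝ → Phase} {G : ℝ → H}
    (hG : ContinuousOn G (Ici 0))
    (hw : ∀ t, 0 ≤ t → w t = U t (w 0) + ∫ s in (0 : ℝ)..t, U (t - s) ((0 : H1), G s)) :
    ∃ D : ℝ → ℝ, ∃ Φ : ℝ → ℝ, Continuous D ∧ (∀ t, HasDerivAt Φ (D t) t) ∧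
      ∀ t, 0 ≤ t → Φ t = phaseNormSq α (w t) ∧
        D t = dissipation γ α (w t) + 2 * ⟪momentum α (w t), G t⟫_ℝ := by
  -- Freezing the force at negative times makes it continuous on the line, so derivatives at time 0
  -- are two-sided.
  set k : ℝ → Phase := fun r => (0, G (max r 0)) with hk
  have hkc : Continuous k := continuous_const.prodMk
    (hG.comp_continuous (continuous_id.max continuous_const) fun r => mem_Ici.2 (le_max_right _ _))
  have hUk : Continuous fun r => U (-r) (k r) := hU.continuous_apply continuous_neg hkc
  set x : ℝ → Phase := fun t => w 0 + ∫ r in (0 : ℝ)..t, U (-r) (k r) with hx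
  have hxd : ∀ t, HasDerivAt x (U (-t) (k t)) t := fun t =>
    (intervalIntegral.integral_hasDerivAt_right (hUk.intervalIntegrable _ _)
      (hUk.stronglyMeasurableAtFilter _ _) hUk.continuousAt).const_add _
  have hxc : Continuous x := continuous_iff_continuousAt.2 fun t => (hxd t).continuousAt
  have hWc : Continuous fun t => U t (x t) := hU.continuous_apply continuous_id hxc
  have hWw : ∀ t, 0 ≤ t → U t (x t) = w t := fun t ht => by
    rw [hw t ht, hx, map_add, hU.duhamel_eq hG ht]
  refine ⟨fun t => dissipation γ α (U t (x t)) + 2 * energyForm α (U t (x t)) (k t),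
    fun t => phaseNormSq α (U t (x t)),
    ((continuous_dissipation γ α).comp hWc).add (continuous_const.mul
      ((continuous_energyForm α).comp (hWc.prodMk hkc))),
    fun t => hU.hasDerivAt_phaseNormSq_forced hα (hxd t), fun t ht => 
      ⟨congrArg (phaseNormSq α) (hWw t ht), ?_⟩⟩
  have : energyForm α (w t) (k t) = ⟪momentum α (w t), G t⟫_ℝ := by
    have h1 : (k t).1 = 0 := rfl
    have h2 : momentum α (k t) = G t := by
      rw [momentum_apply, h1, show H1.toL2 0 = 0 from rfl, smul_zero, add_zero]
      simp [hk, max_eq_left ht]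
    rw [energyForm, h1, h2, inner_zero_right, zero_add]
  simp only
  rw [hWw t ht, this]

lemma dissipation_add_le {γ c : ℝ} (hγ : 0 < γ) {y : Phase} {g : H}
    (hg : ‖g‖ ≤ c * ‖y.1‖) (hc : 0 ≤ c) :
    dissipation γ (decayRate γ) y + 2 * ⟪momentum (decayRate γ) y, g⟫_ℝ ≤
      (-(3 / 2) * decayRate γ + c) * phaseNormSq (decayRate γ) y := by
  have h1 := dissipation_le hγ y
  set α := decayRate γ
  have h2 : ⟪momentum α y, g⟫_ℝ ≤ ‖momentum α y‖ * (c * ‖y.1‖) :=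
    (real_inner_le_norm _ _).trans (mul_le_mul_of_nonneg_left hg (norm_nonneg _))
  have hE : phaseNormSq α y = ‖y.1‖ ^ 2 + ‖momentum α y‖ ^ 2 := by
    rw [phaseNormSq, ← momentum_apply]
  have h3 : 2 * (‖momentum α y‖ * (c * ‖y.1‖)) ≤ c * phaseNormSq α y := by
    rw [hE]
    nlinarith [mul_nonneg hc (sq_nonneg (‖y.1‖ - ‖momentum α y‖))]
  linarith

/-- A pair of paths in the phase space whose difference solves the mild form of
`ẅ + A w + γ ẇ = -(1 - P_N) (f(u) - f(v))`. -/
structure IsDifferencePair (γ m : ℝ) (e : HilbertBasis ℕ ℝ H) (N : ℕ)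
    (U : ℝ → Phase →L[ℝ] Phase) (y z : ℝ → Phase) : Prop where
  cont_left : ContinuousOn y (Ici 0)
  cont_right : ContinuousOn z (Ici 0)
  mild : ∀ t, 0 ≤ t → y t - z t = U t (y 0 - z 0)
    + ∫ s in (0 : ℝ)..t, U (t - s)
        ((0 : H1), -tailProj e N (nonlin m (y s).1 - nonlin m (z s).1))

namespace IsDifferencePair

variable {γ m : ℝ} {e : HilbertBasis ℕ ℝ H} {N : ℕ} {U : ℝ → Phase →L[ℝ] Phase}
  {y z : ℝ → Phase}

/-- Reduces both stability estimates to bounding the projected nonlinearity relative to `‖w‖₁`; the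
factor `c` may be chosen separately at each time. -/
lemma exists_energy (h : IsDifferencePair γ m e N U y z) (hU : IsWaveGroup γ U) (hγ : 0 < γ)
    (hm : 0 < m) : ∃ D : ℝ → ℝ, ∃ Φ : ℝ → ℝ, Continuous D ∧ (∀ t, HasDerivAt Φ (D t) t) ∧
      ∀ t, 0 ≤ t → Φ t = phaseNormSq (decayRate γ) (y t - z t) ∧
        ∀ c, 0 ≤ c → ‖tailProj e N (nonlin m (y t).1 - nonlin m (z t).1)‖ ≤
            c * ‖(y t).1 - (z t).1‖ →
          D t ≤ (-(3 / 2) * decayRate γ + c) * Φ t := by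
  have hG : ContinuousOn (fun s => -tailProj e N (nonlin m (y s).1 - nonlin m (z s).1))
      (Ici 0) := by
    refine ((tailProj e N).continuous.comp_continuousOn ?_).neg
    exact ((continuous_nonlin hm).comp_continuousOn (continuous_fst.comp_continuousOn
      h.cont_left)).sub ((continuous_nonlin hm).comp_continuousOn
        (continuous_fst.comp_continuousOn h.cont_right))
  obtain ⟨D, Φ, hDc, hΦ, hEq⟩ := hU.exists_energy_extension (decayRate_pos hγ).le
    (w := fun t => y t - z t) hG h.mild
  refine ⟨D, Φ, hDc, hΦ, fun t ht => ⟨(hEq t ht).1, fun c hc hcG => ?_⟩⟩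
  rw [(hEq t ht).1, (hEq t ht).2]
  exact dissipation_add_le hγ (by rw [norm_neg]; exact hcG) hc

/-- The stability estimate without projection gain. -/
lemma phaseNormSq_le (hU : IsWaveGroup γ U) (hγ : 0 < γ) (hm0 : 0 < m) (hm1 : m < 1) :
    ∃ C : ℝ, 0 < C ∧ ∀ (e : HilbertBasis ℕ ℝ H) (N : ℕ) (y z : ℝ → Phase),
      IsDifferencePair γ m e N U y z → ∀ s t : ℝ, 0 ≤ s → s ≤ t →
        phaseNormSq (decayRate γ) (y t - z t) ≤ phaseNormSq (decayRate γ) (y s - z s) *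
          Real.exp (-decayRate γ * (t - s) + C * ∫ r in s..t, (‖(y r).1‖ ^ 2 + ‖(z r).1‖ ^ 2)) := by
  have hα := decayRate_pos hγ
  -- Since `2m + 1 ≤ 3`, the constant term becomes `α/2`, exactly the reserve; `24 C` comes from `3
  -- C · 4 (a + b)² ≤ 24 C (a² + b²)`.
  obtain ⟨C, hC, hY⟩ := exists_rpow_two_mul_le hm0 hm1 (κ := decayRate γ / 6) (by positivity)
  refine ⟨24 * C, by positivity, fun e N y z h s t hs hst => ?_⟩
  obtain ⟨D, Φ, hDc, hΦ, hEq⟩ := h.exists_energy hU hγ hm0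
  have hb : ContinuousOn (fun r => ‖(y r).1‖ ^ 2 + ‖(z r).1‖ ^ 2) (Ici 0) :=
    ((continuous_fst.comp_continuousOn h.cont_left).norm.pow 2).add
      ((continuous_fst.comp_continuousOn h.cont_right).norm.pow 2)
  have key := le_mul_exp_of_hasDerivAt_le (α := decayRate γ) (C := 24 * C) hΦ hb (fun r hr => ?_)
    hs hst
  · rwa [(hEq t (hs.trans hst)).1, (hEq s hs).1] at key
  · set c : ℝ := decayRate γ / 2 + 24 * C * (‖(y r).1‖ ^ 2 + ‖(z r).1‖ ^ 2) with hc
    have hc0 : 0 ≤ c := by positivity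
    have h1 := hY (2 * (‖(y r).1‖ + ‖(z r).1‖)) (by positivity)
    have h2 : (2 * m + 1) * (2 * (‖(y r).1‖ + ‖(z r).1‖)) ^ (2 * m) ≤ c := by
      have h3 : (2 * m + 1) * (2 * (‖(y r).1‖ + ‖(z r).1‖)) ^ (2 * m) ≤
          3 * (decayRate γ / 6 + C * (2 * (‖(y r).1‖ + ‖(z r).1‖)) ^ 2) := by
        gcongr
        linarith
      rw [hc]
      nlinarith [mul_nonneg hC.le (sq_nonneg (‖(y r).1‖ - ‖(z r).1‖))]
    have h4 := (hEq r hr).2 c hc0 (((norm_tailProj_apply_le e N _).trans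
      (norm_nonlin_sub_le hm0 _ _)).trans (mul_le_mul_of_nonneg_right h2 (norm_nonneg _)))
    refine h4.trans (le_of_eq ?_)
    rw [hc]
    ring

/-- The stability estimate in terms of the weighted norms. -/
lemma ofReal_phaseNormSq_le (hU : IsWaveGroup γ U) (hγ : 0 < γ) (hm0 : 0 < m) (hm1 : m < 1)
    (e : HilbertBasis ℕ ℝ H) {ε : ℝ} (hε : 0 < ε) :
    ∃ T₀ : ℝ, 0 < T₀ ∧ ∃ N : ℕ, 1 ≤ N ∧ ∀ y z : ℝ → Phase,
      IsDifferencePair γ m e N U y z → ∀ s t : ℝ, T₀ ≤ s → s ≤ t →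
        ENNReal.ofReal (phaseNormSq (decayRate γ) (y t - z t)) ≤
          ENNReal.ofReal (phaseNormSq (decayRate γ) (y s - z s)) *
            EReal.exp (((-decayRate γ * (t - s) : ℝ) : EReal) +
              ((ENNReal.ofReal ε * ∫⁻ r in Icc s t,
                (‖(y r).1‖ₑ ^ 2 + ‖(z r).1‖ₑ ^ 2 + weightedNormSq r (y r).1
                  + weightedNormSq r (z r).1) : ℝ≥0∞) : EReal)) := by
  have hα := decayRate_pos hγ
  -- In `δ (1 + q)` the term `δ ≤ α/2` uses up the reserve, and `δ q ≤ ε q` is the stated rate.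
  obtain ⟨T₀, hT₀, N, hN, hkey⟩ := exists_norm_tailProj_nonlin_sub_le_weighted hm0 hm1 e
    (δ := min (decayRate γ / 2) ε) (by positivity)
  refine ⟨T₀, hT₀, N, hN, fun y z h s t hs hst => ?_⟩
  have hs0 : 0 ≤ s := hT₀.le.trans hs
  rcases (phaseNormSq_nonneg (decayRate γ) (y t - z t)).eq_or_lt with h0 | hpos
  · rw [← h0, ENNReal.ofReal_zero]
    exact zero_le
  obtain ⟨D, Φ, hDc, hΦ, hEq⟩ := h.exists_energy hU hγ hm0
  obtain ⟨C, -, hC⟩ := phaseNormSq_le hU hγ hm0 hm1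
  -- By the first estimate, vanishing energy at time `r` would force it to vanish at `t`; hence `log
  -- Φ` is defined on the whole interval.
  have hΦpos : ∀ r ∈ Icc s t, 0 < Φ r := fun r hr => by
    rw [(hEq r (hs0.trans hr.1)).1]
    exact pos_of_mul_pos_left (hpos.trans_le (hC e N y z h r t (hs0.trans hr.1) hr.2))
      (Real.exp_nonneg _)
  rw [← (hEq t (hs0.trans hst)).1, ← (hEq s hs0).1]
  refine ofReal_le_mul_exp_lintegral ENNReal.ofReal_ne_top hΦ hDc hst hΦpos fun r hr => ?_
  have hε' : ENNReal.ofReal ε ≠ 0 := by simpa using hε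
  by_cases hy : weightedNormSq r (y r).1 = ∞
  · simp [hy, hε']
  by_cases hz : weightedNormSq r (z r).1 = ∞
  · simp [hz, hε']
  set q : ℝ := ‖(y r).1‖ ^ 2 + ‖(z r).1‖ ^ 2 + (weightedNormSq r (y r).1).toReal
    + (weightedNormSq r (z r).1).toReal with hq
  have hq0 : 0 ≤ q := by positivity
  have hrhs : ENNReal.ofReal ε * (‖(y r).1‖ₑ ^ 2 + ‖(z r).1‖ₑ ^ 2 + weightedNormSq r (y r).1
      + weightedNormSq r (z r).1) = ENNReal.ofReal (ε * q) := by
    rw [ENNReal.ofReal_mul hε.le, hq, ENNReal.ofReal_add (by positivity) (by positivity),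
      ENNReal.ofReal_add (by positivity) (by positivity),
      ENNReal.ofReal_add (by positivity) (by positivity), ENNReal.ofReal_toReal hy,
      ENNReal.ofReal_toReal hz, ENNReal.ofReal_pow (norm_nonneg _),
      ENNReal.ofReal_pow (norm_nonneg _), ofReal_norm, ofReal_norm]
  rw [hrhs]
  refine ENNReal.ofReal_le_ofReal ?_
  have hδ1 : min (decayRate γ / 2) ε ≤ decayRate γ / 2 := min_le_left _ _
  have hδ2 : min (decayRate γ / 2) ε ≤ ε := min_le_right _ _
  have hδ0 : 0 < min (decayRate γ / 2) ε := by positivity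
  have h1 := (hEq r (hs0.trans hr.1)).2 _ (mul_nonneg hδ0.le (by positivity : 0 ≤ 1 + q))
    (hkey r (y r).1 (z r).1 (hs.trans hr.1) hy hz)
  have h2 : D r / Φ r ≤ -(3 / 2) * decayRate γ + min (decayRate γ / 2) ε * (1 + q) := by
    rwa [div_le_iff₀ (hΦpos r hr)]
  have h3 : min (decayRate γ / 2) ε * q ≤ ε * q := by gcongr
  linarith

end IsDifferencePair

/-! ### The stochastic convolution -/

section Stochastic

variable {Ω : Type u} {mΩ : MeasurableSpace Ω}

lemma summable_smul_hilbertBasis_iff (e : HilbertBasis ℕ ℝ H) (a : ℕ → ℝ) :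
    (Summable fun i => a i • e i) ↔ Summable fun i => a i ^ 2 := by
  have h := e.orthonormal.orthogonalFamily.summable_iff_norm_sq_summable a
  simpa using h

lemma measurableSet_summable_sq {X : ℕ → Ω → ℝ} (hX : ∀ i, Measurable (X i)) :
    MeasurableSet {ω | Summable fun i => X i ω ^ 2} := by
  have : {ω | Summable fun i => X i ω ^ 2} =
      {ω | ∑' i, ENNReal.ofReal (X i ω ^ 2) ≠ ∞} := by
    ext ω
    constructor
    · intro h
      exact h.tsum_ofReal_ne_top
    · intro h
      have := ENNReal.summable_toReal h
      simpa [ENNReal.toReal_ofReal (sq_nonneg _)] using this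
  rw [this]
  exact (measurableSet_singleton _).compl.preimage
    (Measurable.tsum fun i => ((hX i).pow_const 2).ennreal_ofReal)

/-- The sum is 0 where the series diverges, so partial sums cut off to the measurable set of
convergence tend to it everywhere. -/
lemma stronglyMeasurable_wiener (e : HilbertBasis ℕ ℝ H) (b : ℕ → ℝ) {β : ℕ → ℝ≥0 → Ω → ℝ}
    {t : ℝ≥0} (hβ : ∀ i, Measurable (β i t)) : StronglyMeasurable (wiener e b β t) := by
  have hX : ∀ i, Measurable fun ω => b i * β i t ω := fun i => (hβ i).const_mul _
  set A : Set Ω := {ω | Summable fun i => (b i * β i t ω) ^ 2} with hA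
  have hAm : MeasurableSet A := measurableSet_summable_sq hX
  refine stronglyMeasurable_of_tendsto atTop
    (f := fun n : ℕ => A.indicator fun ω => ∑ i ∈ Finset.range n, (b i * β i t ω) • e i)
    (fun n => StronglyMeasurable.indicator ?_ hAm) ?_
  · exact Finset.stronglyMeasurable_fun_sum _ fun i _ => (hX i).stronglyMeasurable.smul_const _
  · refine tendsto_pi_nhds.2 fun ω => ?_
    by_cases hω : ω ∈ A
    · simp only [indicator_of_mem hω]
      exact ((summable_smul_hilbertBasis_iff e _).2 hω).hasSum.tendsto_sum_nat
    · simp only [indicator_of_notMem hω]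
      rw [wiener, tsum_eq_zero_of_not_summable
        (mt (summable_smul_hilbertBasis_iff e _).1 hω)]
      exact tendsto_const_nhds

lemma stronglyMeasurable_itoSum (γ : ℝ) {W : ℝ≥0 → Ω → H} (hW : ∀ t, StronglyMeasurable (W t))
    (t : ℝ≥0) (n : ℕ) : StronglyMeasurable (itoSum γ W t n) := by
  unfold itoSum
  refine Finset.stronglyMeasurable_fun_sum _ fun k _ => ?_
  exact (waveGroup γ _).continuous.comp_stronglyMeasurable
    (stronglyMeasurable_const.prodMk ((hW _).sub (hW _)))

/-- The stochastic convolution is unique up to modification. -/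
lemma IsStochasticConvolution.ae_eq {γ : ℝ} {P : Measure Ω} {W : ℝ≥0 → Ω → H}
    (hW : ∀ t, StronglyMeasurable (W t)) {Z Z' : ℝ≥0 → Ω → Phase}
    (hZ : IsStochasticConvolution γ P W Z) (hZ' : IsStochasticConvolution γ P W Z') (t : ℝ≥0) :
    Z t =ᵐ[P] Z' t := by
  have hI : ∀ n, AEStronglyMeasurable (fun ω => itoSum γ W t n ω) P := fun n =>
    (stronglyMeasurable_itoSum γ hW t n).aestronglyMeasurable
  have h0 : eLpNorm (Z t - Z' t) 2 P = 0 := by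
    refine le_antisymm ?_ zero_le
    have hlim := (hZ t).2.add (hZ' t).2
    rw [add_zero] at hlim
    refine ge_of_tendsto' hlim fun n => ?_
    have e : Z t - Z' t = (fun ω => itoSum γ W t n ω - Z' t ω)
        - fun ω => itoSum γ W t n ω - Z t ω := by
      funext ω; simp
    rw [e, add_comm]
    exact eLpNorm_sub_le ((hI n).sub (hZ' t).1) ((hI n).sub (hZ t).1) (by norm_num)
  rw [eLpNorm_eq_zero_iff ((hZ t).1.sub (hZ' t).1) (by norm_num)] at h0
  filter_upwards [h0] with ω hω
  exact sub_eq_zero.1 hω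

/-- Almost surely, the difference of two solutions satisfies the difference of the mild
equations without noise at a dense set of times. -/
lemma IsSolutionPair.ae_dense {γ m : ℝ} {e : HilbertBasis ℕ ℝ H} {N : ℕ} {P : Measure Ω}
    {ℱ : Filtration ℝ≥0 mΩ} {β : ℕ → ℝ≥0 → Ω → ℝ} {b : ℕ → ℝ} {h : H} {ξu ξv : ℝ → Ω → Phase}
    (hs : IsSolutionPair γ m e N P ℱ β b h ξu ξv) :
    ∀ᵐ ω ∂P, ContinuousOn (fun t => ξu t ω) (Ici 0) ∧ ContinuousOn (fun t => ξv t ω) (Ici 0) ∧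
      ∀ n, ∀ t : ℝ≥0, t = TopologicalSpace.denseSeq ℝ≥0 n → ξu t ω - ξv t ω =
        (waveGroup γ t (ξu 0 ω) + ∫ s in (0 : ℝ)..t,
            waveGroup γ (t - s) ((0 : H1), h - nonlin m (ξu s ω).1)) -
        (waveGroup γ t (ξv 0 ω) + ∫ s in (0 : ℝ)..t,
            waveGroup γ (t - s) ((0 : H1), h - nonlin m (ξv s ω).1
              - proj e N (nonlin m (ξu s ω).1 - nonlin m (ξv s ω).1))) := by
  have hW : ∀ t, StronglyMeasurable (wiener e b β t) := fun t =>
    stronglyMeasurable_wiener e b fun i => (hs.brownian.adapted i t).mono (ℱ.le t) le_rfl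
  obtain ⟨Zu, hZu, hu⟩ := hs.solves_u.mild
  obtain ⟨Zv, hZv, hv⟩ := hs.solves_v.mild
  filter_upwards [hs.solves_u.cont, hs.solves_v.cont, hu, hv,
    -- The null set on which the two convolutions differ depends on the time, so only countably many
    -- times are used.
    ae_all_iff.2 fun n => hZu.ae_eq hW hZv (TopologicalSpace.denseSeq ℝ≥0 n)]
    with ω h1 h2 h3 h4 h5
  refine ⟨h1, h2, fun n t ht => ?_⟩
  have h6 := h5 n
  rw [← ht] at h6
  rw [h3 t, h4 t, h6]
  abel

lemma eqOn_Ici_of_dense {f g : ℝ → Phase} (hf : ContinuousOn f (Ici 0))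
    (hg : ContinuousOn g (Ici 0))
    (h : ∀ n, ∀ t : ℝ≥0, t = TopologicalSpace.denseSeq ℝ≥0 n → f t = g t) {t : ℝ} (ht : 0 ≤ t) :
    f t = g t := by
  have hf' : Continuous fun t : ℝ≥0 => f t :=
    hf.comp_continuous NNReal.continuous_coe fun t => mem_Ici.2 t.2
  have hg' : Continuous fun t : ℝ≥0 => g t :=
    hg.comp_continuous NNReal.continuous_coe fun t => mem_Ici.2 t.2
  have := (TopologicalSpace.denseRange_denseSeq ℝ≥0).equalizer hf' hg'
    (funext fun n => h n _ rfl)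
  exact congrFun this ⟨t, ht⟩

lemma IsSolutionPair.ae_isDifferencePair {γ m : ℝ} (hm : 0 < m) {e : HilbertBasis ℕ ℝ H} {N : ℕ}
    {P : Measure Ω} {ℱ : Filtration ℝ≥0 mΩ} {β : ℕ → ℝ≥0 → Ω → ℝ} {b : ℕ → ℝ} {h : H}
    {ξu ξv : ℝ → Ω → Phase} (hs : IsSolutionPair γ m e N P ℱ β b h ξu ξv)
    (hU : IsWaveGroup γ (waveGroup γ)) :
    ∀ᵐ ω ∂P, IsDifferencePair γ m e N (waveGroup γ) (fun t => ξu t ω) (fun t => ξv t ω) := by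
  filter_upwards [hs.ae_dense] with ω ⟨h1, h2, h3⟩
  refine ⟨h1, h2, fun t ht => ?_⟩
  have hfu : ContinuousOn (fun s => nonlin m (ξu s ω).1) (Ici 0) :=
    (continuous_nonlin hm).comp_continuousOn (continuous_fst.comp_continuousOn h1)
  have hfv : ContinuousOn (fun s => nonlin m (ξv s ω).1) (Ici 0) :=
    (continuous_nonlin hm).comp_continuousOn (continuous_fst.comp_continuousOn h2)
  have hd : ContinuousOn (fun s => tailProj e N (nonlin m (ξu s ω).1 - nonlin m (ξv s ω).1))
      (Ici 0) := (tailProj e N).continuous.comp_continuousOn (hfu.sub hfv)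
  have hgu : ContinuousOn (fun s => h - nonlin m (ξu s ω).1) (Ici 0) := continuousOn_const.sub hfu
  have hgv : ContinuousOn (fun s => h - nonlin m (ξv s ω).1
      - proj e N (nonlin m (ξu s ω).1 - nonlin m (ξv s ω).1)) (Ici 0) := by
    have : (fun s => h - nonlin m (ξv s ω).1
        - proj e N (nonlin m (ξu s ω).1 - nonlin m (ξv s ω).1)) =
        fun s => h - nonlin m (ξu s ω).1
          + tailProj e N (nonlin m (ξu s ω).1 - nonlin m (ξv s ω).1) := by
      funext s; rw [tailProj_apply]; abel
    rw [this]
    exact hgu.add hd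
  refine eqOn_Ici_of_dense (f := fun t => ξu t ω - ξv t ω)
    (g := fun t => waveGroup γ t (ξu 0 ω - ξv 0 ω) + ∫ s in (0 : ℝ)..t, waveGroup γ (t - s)
      ((0 : H1), -tailProj e N (nonlin m (ξu s ω).1 - nonlin m (ξv s ω).1)))
    (h1.sub h2) ((hU.cont _).continuousOn.add (hU.continuousOn_duhamel hd.neg))
    (fun n t hn => ?_) ht
  have hint : ∀ {G : ℝ → H}, ContinuousOn G (Ici 0) → IntervalIntegrable
      (fun s => waveGroup γ (t - s) ((0 : H1), G s)) volume 0 t := fun {G} hG => by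
    have hc : Continuous fun s : ℝ => waveGroup γ (t - s) ((0 : H1), G (max s 0)) :=
      hU.continuous_apply (continuous_const.sub continuous_id) (continuous_const.prodMk
        (hG.comp_continuous (continuous_id.max continuous_const)
          fun r => mem_Ici.2 (le_max_right _ _)))
    refine (hc.intervalIntegrable 0 t).congr fun s hs => ?_
    rw [uIoc_of_le t.coe_nonneg] at hs
    simp only [max_eq_left hs.1.le]
  rw [h3 n t hn, add_sub_add_comm, ← map_sub,
    ← intervalIntegral.integral_sub (hint hgu) (hint hgv)]
  congr 1
  refine intervalIntegral.integral_congr fun s _ => ?_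
  rw [← map_sub, Prod.mk_sub_mk, sub_zero, tailProj_apply]
  congr 2
  abel

/-- Covers the default value of `waveGroup`: both mild equations then reduce to the same stochastic
convolution. This lets the theorem be proved without constructing the group. -/
lemma IsSolutionPair.ae_eq_zero {γ m : ℝ} {e : HilbertBasis ℕ ℝ H} {N : ℕ}
    {P : Measure Ω} {ℱ : Filtration ℝ≥0 mΩ} {β : ℕ → ℝ≥0 → Ω → ℝ} {b : ℕ → ℝ} {h : H}
    {ξu ξv : ℝ → Ω → Phase} (hs : IsSolutionPair γ m e N P ℱ β b h ξu ξv)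
    (hU : waveGroup γ = 0) : ∀ᵐ ω ∂P, ∀ t : ℝ, 0 ≤ t → ξu t ω - ξv t ω = 0 := by
  filter_upwards [hs.ae_dense] with ω ⟨h1, h2, h3⟩ t ht
  refine eqOn_Ici_of_dense (f := fun t => ξu t ω - ξv t ω) (g := fun _ => 0) (h1.sub h2)
    continuousOn_const (fun n t hn => ?_) ht
  rw [h3 n t hn, hU]
  simp

end Stochastic

/-- The defining property of `waveGroup`; the second alternative is the default value, for which
the existence of the group would have to fail. -/
lemma isWaveGroup_waveGroup_or (γ : ℝ) : IsWaveGroup γ (waveGroup γ) ∨ waveGroup γ = 0 := by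
  unfold waveGroup
  split_ifs with h
  · exact Or.inl h.choose_spec
  · exact Or.inr rfl

end WaveLine

theorem theorem2p3 (γ m : ℝ) (hγ : 0 < γ) (hm0 : 0 < m) (hm1 : m < 1) :
    ∃ α : ℝ, 0 < α ∧
      (∃ C : ℝ, 0 < C ∧
        ∀ (e : HilbertBasis ℕ ℝ H) (N : ℕ), 1 ≤ N →
        ∀ (Ω : Type u) (mΩ : MeasurableSpace Ω) (P : Measure Ω) (_ : IsProbabilityMeasure P)
          (ℱ : Filtration ℝ≥0 mΩ) (β : ℕ → ℝ≥0 → Ω → ℝ) (b : ℕ → ℝ) (h : H)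
          (ξu ξv : ℝ → Ω → Phase),
        IsSolutionPair γ m e N P ℱ β b h ξu ξv →
        ∀ᵐ ω ∂P, ∀ s t : ℝ, 0 ≤ s → s ≤ t →
          phaseNormSq α (ξu t ω - ξv t ω) ≤
            phaseNormSq α (ξu s ω - ξv s ω) *
              Real.exp (-α * (t - s) +
                C * ∫ r in s..t, (‖(ξu r ω).1‖ ^ 2 + ‖(ξv r ω).1‖ ^ 2))) ∧
      (∃ Cstar : ℝ, 0 < Cstar ∧
        ∀ (e : HilbertBasis ℕ ℝ H) (ε : ℝ), 0 < ε →
        ∃ T₀ : ℝ, 0 < T₀ ∧ ∃ N : ℕ, 1 ≤ N ∧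
        ∀ (Ω : Type u) (mΩ : MeasurableSpace Ω) (P : Measure Ω) (_ : IsProbabilityMeasure P)
          (ℱ : Filtration ℝ≥0 mΩ) (β : ℕ → ℝ≥0 → Ω → ℝ) (b : ℕ → ℝ) (h : H)
          (ξu ξv : ℝ → Ω → Phase),
        IsSolutionPair γ m e N P ℱ β b h ξu ξv →
        ∀ᵐ ω ∂P, ∀ s t : ℝ, 0 ≤ s → s ≤ t →
          ENNReal.ofReal (phaseNormSq α (ξu (t + T₀) ω - ξv (t + T₀) ω)) ≤
            ENNReal.ofReal (phaseNormSq α (ξu (s + T₀) ω - ξv (s + T₀) ω)) *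
              EReal.exp (((-α * (t - s) : ℝ) : EReal) +
                ((ENNReal.ofReal (Cstar * ε) *
                  ∫⁻ r in Set.Icc (s + T₀) (t + T₀),
                    (‖(ξu r ω).1‖ₑ ^ 2 + ‖(ξv r ω).1‖ₑ ^ 2
                      + weightedNormSq r (ξu r ω).1 + weightedNormSq r (ξv r ω).1) : ℝ≥0∞) :
                  EReal))) := by
  have hα := decayRate_pos hγ
  -- `C_* = 1` suffices because `T₀` and `N` are chosen after `ε`.
  refine ⟨decayRate γ, hα, ?_, 1, one_pos, ?_⟩
  · rcases isWaveGroup_waveGroup_or γ with hU | hU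
    · obtain ⟨C, hC, key⟩ := IsDifferencePair.phaseNormSq_le hU hγ hm0 hm1
      refine ⟨C, hC, fun e N _ Ω mΩ P _ ℱ β b h ξu ξv hs => ?_⟩
      filter_upwards [hs.ae_isDifferencePair hm0 hU] with ω hω
      exact key e N _ _ hω
    · refine ⟨1, one_pos, fun e N _ Ω mΩ P _ ℱ β b h ξu ξv hs => ?_⟩
      filter_upwards [hs.ae_eq_zero hU] with ω hω s t h0 hst
      rw [hω s h0, hω t (h0.trans hst), phaseNormSq_zero, zero_mul]
  · intro e ε hε
    rcases isWaveGroup_waveGroup_or γ with hU | hU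
    · obtain ⟨T₀, hT₀, N, hN, key⟩ :=
        IsDifferencePair.ofReal_phaseNormSq_le hU hγ hm0 hm1 e hε
      refine ⟨T₀, hT₀, N, hN, fun Ω mΩ P _ ℱ β b h ξu ξv hs => ?_⟩
      filter_upwards [hs.ae_isDifferencePair hm0 hU] with ω hω s t h0 hst
      have := key _ _ hω (s + T₀) (t + T₀) (le_add_of_nonneg_left h0) (add_le_add hst le_rfl)
      rwa [add_sub_add_right_eq_sub, ← one_mul ε] at this
    · refine ⟨1, one_pos, 1, le_rfl, fun Ω mΩ P _ ℱ β b h ξu ξv hs => ?_⟩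
      filter_upwards [hs.ae_eq_zero hU] with ω hω s t h0 hst
      rw [hω (t + 1) (by linarith), phaseNormSq_zero, ENNReal.ofReal_zero]
      exact zero_le
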